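/- **Indistinguishability property of saturated bisimilarity for tagged lqCCS.** *Processes.* Let qubit names, variables, channels and tags range over denumerable sets; variables and channels carry one of the types $\mathbb B,\mathbb N,\mathcal Q$ (booleans, naturals, qubit names). Tagged lqCCS processes are $$P ::= t{:}\tau.P \mid (t,t'){:}\tau.P \mid t{:}\mathcal E(\tilde e).P \mid t{:}\mathbb M(\tilde e\rhd y).P \mid t{:}c?x.P \mid t{:}c!e.P \mid \mathbf 0_{\tilde e} \mid \mathbf{if}\ e\ \mathbf{then}\ P\ \mathbf{else}\ P \mid P+P \mid P\parallel P \mid P\setminus c,$$ with $e ::= x\mid b\mid n\mid q\mid \neg e\mid e\vee e\mid e\le e\mid e=e$, where $\mathcal E$ is a trace-preserving superoperator (given by a Kraus decomposition) and $\mathbb M=\{M_m\}_m$ a measurement ($\sum_m M_m^\dagger M_m=\mathbb I$). The linear type system derives $\Sigma\vdash P$, meaning that $P$ uses exactly the qubits in $\Sigma$, each owned by one parallel component: $\mathbf 0_{\tilde e}$ owns exactly the (pairwise distinct) qubits $\tilde e$; $\mathcal E$ and $\mathbb M$ act on tuples of distinct owned qubits of the right length; sending a qubit gives up its ownership and receiving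 one acquires it; both sides of a sum or conditional own the same qubits; the two sides of $\parallel$ own disjoint sets; expressions are used at their types. *Semantics.* A configuration $\langle\rho,P\rangle$ consists of a density operator $\rho$ of trace one on a finite set $\Sigma_\rho$ of qubits and a closed process $P$; $(\Sigma_\rho,\Sigma)\vdash\langle\rho,P\rangle$ means $\Sigma\vdash P$ and $\Sigma\subseteq\Sigma_\rho$. Schedulers are $s::=h\mid t\mid (t,t')$ and actions are $\tau$, $c!v$, $c?v$. Transitions $\langle\rho,P\rangle\xrightarrow{\mu}_s\Delta$, with $\Delta$ a finitely supported probability distribution on configurations, are those of CCS with value passing, where a prefix with tag $t$ (pair $(t,t')$) is executed under the scheduler $t$ ($(t,t')$), a synchronization of an output tagged $t$ with an input tagged $t'$ is a $\tau$-transition under $(t,t')$, a qubit $v$ can be received only if $v\in\Sigma_\rho$, and, in a parallel composition, a component moving alone can receive a qubit only if the other component does not own it; moreover $$\langle\rho,t{:}\mathcal E(\tilde q).P\rangle\xrightarrow{\tau}_t\overline{\langle\mathcal E^{\tilde q}(\rho),P\rangle},\qquad \langle\rho,t{:}\mathbb M(\tilde q\rhd y).P\rangle\xrightarrow{\tau}_t\sum_m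 p_m\bullet\overline{\big\langle \tfrac1{p_m}\mathcal M_m^{\tilde q}(\rho),P[m/y]\big\rangle},\quad p_m=\mathrm{tr}\,\mathcal M_m^{\tilde q}(\rho),$$ where $\mathcal M_m(\sigma)=M_m\sigma M_m^\dagger$, the superscript $\tilde q$ means "acting on the qubits $\tilde q$ and as the identity on the others", and $\overline{x}$ is the point distribution at $x$. There is a further deadlock configuration $\bot$, which has every type; $\bot$, and every configuration without a $\mu$-transition under $s$, moves to $\overline\bot$ under $\mu$ and $s$. This relation is lifted linearly, first to distributions $\delta$ of schedulers and then to distributions of configurations, giving $\Delta\xrightarrow{\mu}_\delta\Delta'$. *Standing assumption (deterministic tagging).* All configurations considered are well-typed and tagged deterministically: they belong to a set of well-typed configurations that contains the well-typed derivatives of its members and on which $\Delta\xrightarrow{\mu}_\delta\Delta'$ and $\Delta\xrightarrow{\mu}_\delta\Delta''$ imply $\Delta'=\Delta''$. Let $\mathit{Conf}$ be the largest such class of configurations, and $D(\mathit{Conf}_\bot)$ the finitely supported probability distributions on $\mathit{Conf}\cup\{\bot\}$. *Saturated bisimilarity.* A context with a hole of type $\Sigma'$ over the qubits $\Sigma$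 is $B[\cdot]=[\cdot]\parallel Q$ with $Q$ closed, $\Sigma''\vdash Q$, $\Sigma''\subseteq\Sigma$ and $\Sigma''\cap\Sigma'=\emptyset$; $B[\Delta]$ is obtained by applying $B$ to the processes in the support of $\Delta$, with $B[\bot]=\bot$. A relation $\mathcal R\subseteq D(\mathit{Conf}_\bot)\times D(\mathit{Conf}_\bot)$ is a saturated bisimulation if $\Delta\,\mathcal R\,\Theta$ implies that $(\Sigma,\Sigma')\vdash\Delta$ and $(\Sigma,\Sigma')\vdash\Theta$ for some $\Sigma,\Sigma'$, that $\Delta(\bot)=\Theta(\bot)$, and that for every such context $B$ with $B[\Delta],B[\Theta]\in D(\mathit{Conf}_\bot)$ and every distribution $\delta$ of schedulers: whenever $B[\Delta]\xrightarrow{\tau}_\delta\Delta'$ there is $\Theta'$ with $B[\Theta]\xrightarrow{\tau}_\delta\Theta'$ and $\Delta'\,\mathcal R\,\Theta'$, and conversely. Saturated bisimilarity $\sim_s$ is the largest saturated bisimulation. **Theorem.** Let $P$ be a process, let $(p_i)_{i\in I}$ and $(q_j)_{j\in J}$ be finite families of non-negative reals with $\sum_i p_i=\sum_j q_j=1$,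 and let $\rho_i$ ($i\in I$) and $\sigma_j$ ($j\in J$) be density operators of trace one on the same finite set of qubits such that all $\langle\rho_i,P\rangle$ and $\langle\sigma_j,P\rangle$ are in $\mathit{Conf}$. If $\sum_i p_i\,\rho_i=\sum_j q_j\,\sigma_j$, then $$\sum_i p_i\bullet\overline{\langle\rho_i,P\rangle}\ \sim_s\ \sum_j q_j\bullet\overline{\langle\sigma_j,P\rangle}.$$ -/

import Mathlib

open scoped ComplexOrder

noncomputable section

namespace LqCCS

/-! ## Syntax of tagged lqCCS -/

/-- The types of values; a channel of type `T` carries values of type `T`. -/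
inductive Ty : Type where
  | bool | nat | qubit
  deriving DecidableEq

/-- Qubit names. -/
abbrev Qubit : Type := ℕ

/-- Tags. -/
abbrev Tag : Type := ℕ

/-- Variables, each with its type. -/
structure Var : Type where
  ty : Ty
  idx : ℕ
  deriving DecidableEq

/-- Channels, each with the type of the values that it carries. -/
structure Chan : Type where
  ty : Ty
  idx : ℕ
  deriving DecidableEq

/-- Values. -/
inductive Value : Type where
  | bool (b : Bool)
  | nat (n : ℕ)
  | qubit (q : Qubit)
  deriving DecidableEq

def Value.ty : Value → Ty
  | .bool _ => .bool
  | .nat _ => .nat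
  | .qubit _ => .qubit

/-- Expressions `x | b | n | q | ¬ e | e ∨ e | e ≤ e | e = e`. -/
inductive Expr : Type where
  | var (x : Var)
  | bool (b : Bool)
  | nat (n : ℕ)
  | qubit (q : Qubit)
  | not (e : Expr)
  | or (e₁ e₂ : Expr)
  | le (e₁ e₂ : Expr)
  | eq (e₁ e₂ : Expr)
  deriving DecidableEq

def Value.toExpr : Value → Expr
  | .bool b => .bool b
  | .nat n => .nat n
  | .qubit q => .qubit q

/-- Operators on the space of `n` qubits, as matrices in the computational basis. -/
abbrev Op (n : ℕ) : Type := Matrix (Fin n → Fin 2) (Fin n → Fin 2) ℂ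

/-- Trace-preserving superoperators on `n` qubits: the maps that have a Kraus decomposition
`{E_i}` with `d ^ 2` members, `d = 2 ^ n`, and `∑ E_i† E_i = 1`. -/
structure Superop (n : ℕ) : Type where
  map : Op n →ₗ[ℂ] Op n
  kraus : ∃ E : Fin ((2 ^ n) ^ 2) → Op n,
    (∑ i, (E i).conjTranspose * E i = 1) ∧
      ∀ ρ : Op n, map ρ = ∑ i, E i * ρ * (E i).conjTranspose

/-- Measurements on `n` qubits with `k` outcomes. -/
structure Meas (n : ℕ) : Type where
  k : ℕ
  M : Fin k → Op n
  complete : ∑ m, (M m).conjTranspose * M m = 1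

/-- The trace non-increasing superoperator `σ ↦ M σ M†`. -/
def conjMap {n : ℕ} (M : Op n) : Op n →ₗ[ℂ] Op n :=
  LinearMap.mulLeft ℂ M ∘ₗ LinearMap.mulRight ℂ M.conjTranspose

/-- Tagged processes. -/
inductive Proc : Type where
  /-- `t : τ . P` -/
  | tau (t : Tag) (P : Proc)
  /-- `(t, t') : τ . P` -/
  | tauPair (t t' : Tag) (P : Proc)
  /-- `t : E(es) . P` -/
  | op (t : Tag) {n : ℕ} (E : Superop n) (es : Fin n → Expr) (P : Proc)
  /-- `t : M(es ▹ y) . P` -/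
  | meas (t : Tag) {n : ℕ} (M : Meas n) (es : Fin n → Expr) (y : Var) (P : Proc)
  /-- `t : c ? x . P` -/
  | recv (t : Tag) (c : Chan) (x : Var) (P : Proc)
  /-- `0_es` -/
  | nil (es : List Expr)
  /-- `t : c ! e . P` -/
  | send (t : Tag) (c : Chan) (e : Expr) (P : Proc)
  /-- `if e then P else Q` -/
  | ite (e : Expr) (P Q : Proc)
  /-- `P + Q` -/
  | sum (P Q : Proc)
  /-- `P ∥ Q` -/
  | par (P Q : Proc)
  /-- `P ∖ c` -/
  | res (P : Proc) (c : Chan)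

/-! ## Variables, substitution, evaluation -/

def Expr.freeVars : Expr → Set Var
  | .var x => {x}
  | .bool _ => ∅
  | .nat _ => ∅
  | .qubit _ => ∅
  | .not e => e.freeVars
  | .or e₁ e₂ => e₁.freeVars ∪ e₂.freeVars
  | .le e₁ e₂ => e₁.freeVars ∪ e₂.freeVars
  | .eq e₁ e₂ => e₁.freeVars ∪ e₂.freeVars

def Proc.freeVars : Proc → Set Var
  | .tau _ P => P.freeVars
  | .tauPair _ _ P => P.freeVars
  | .op _ _ es P => (⋃ k, (es k).freeVars) ∪ P.freeVars
  | .meas _ _ es y P => (⋃ k, (es k).freeVars) ∪ (P.freeVars \ {y})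
  | .recv _ _ x P => P.freeVars \ {x}
  | .nil es => {x | ∃ e ∈ es, x ∈ e.freeVars}
  | .send _ _ e P => e.freeVars ∪ P.freeVars
  | .ite e P Q => e.freeVars ∪ P.freeVars ∪ Q.freeVars
  | .sum P Q => P.freeVars ∪ Q.freeVars
  | .par P Q => P.freeVars ∪ Q.freeVars
  | .res P _ => P.freeVars

def Proc.Closed (P : Proc) : Prop := P.freeVars = ∅

/-- `e[v/x]` -/
def Expr.subst (x : Var) (v : Value) : Expr → Expr
  | .var y => if y = x then v.toExpr else .var y
  | .bool b => .bool b
  | .nat n => .nat n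
  | .qubit q => .qubit q
  | .not e => .not (e.subst x v)
  | .or e₁ e₂ => .or (e₁.subst x v) (e₂.subst x v)
  | .le e₁ e₂ => .le (e₁.subst x v) (e₂.subst x v)
  | .eq e₁ e₂ => .eq (e₁.subst x v) (e₂.subst x v)

/-- `P[v/x]`; the binders are `M(es ▹ y) . P` and `c ? x . P`. -/
def Proc.subst (x : Var) (v : Value) : Proc → Proc
  | .tau t P => .tau t (P.subst x v)
  | .tauPair t t' P => .tauPair t t' (P.subst x v)
  | .op t E es P => .op t E (fun k => (es k).subst x v) (P.subst x v)
  | .meas t M es y P =>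
      .meas t M (fun k => (es k).subst x v) y (if y = x then P else P.subst x v)
  | .recv t c y P => .recv t c y (if y = x then P else P.subst x v)
  | .nil es => .nil (es.map (Expr.subst x v))
  | .send t c e P => .send t c (e.subst x v) (P.subst x v)
  | .ite e P Q => .ite (e.subst x v) (P.subst x v) (Q.subst x v)
  | .sum P Q => .sum (P.subst x v) (Q.subst x v)
  | .par P Q => .par (P.subst x v) (Q.subst x v)
  | .res P c => .res (P.subst x v) c

/-- Evaluation; `e ⇓ v` is `e.eval = some v`. Free variables are not evaluated, and `q = q'`
compares the names of qubits. -/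
def Expr.eval : Expr → Option Value
  | .var _ => none
  | .bool b => some (.bool b)
  | .nat n => some (.nat n)
  | .qubit q => some (.qubit q)
  | .not e =>
      match e.eval with
      | some (.bool b) => some (.bool (!b))
      | _ => none
  | .or e₁ e₂ =>
      match e₁.eval, e₂.eval with
      | some (.bool a), some (.bool b) => some (.bool (a || b))
      | _, _ => none
  | .le e₁ e₂ =>
      match e₁.eval, e₂.eval with
      | some (.nat a), some (.nat b) => some (.bool (decide (a ≤ b)))
      | _, _ => none
  | .eq e₁ e₂ =>
      match e₁.eval, e₂.eval with
      | some (.bool a), some (.bool b) => some (.bool (decide (a = b)))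
      | some (.nat a), some (.nat b) => some (.bool (decide (a = b)))
      | some (.qubit a), some (.qubit b) => some (.bool (decide (a = b)))
      | _, _ => none

/-! ## The linear type system -/

/-- Types of expressions. -/
inductive Expr.HasTy : Expr → Ty → Prop where
  | var (x : Var) : HasTy (.var x) x.ty
  | bool (b : Bool) : HasTy (.bool b) .bool
  | nat (n : ℕ) : HasTy (.nat n) .nat
  | qubit (q : Qubit) : HasTy (.qubit q) .qubit
  | not {e : Expr} : HasTy e .bool → HasTy (.not e) .bool
  | or {e₁ e₂ : Expr} : HasTy e₁ .bool → HasTy e₂ .bool → HasTy (.or e₁ e₂) .bool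
  | le {e₁ e₂ : Expr} : HasTy e₁ .nat → HasTy e₂ .nat → HasTy (.le e₁ e₂) .bool
  | eq {e₁ e₂ : Expr} {T : Ty} : HasTy e₁ T → HasTy e₂ T → HasTy (.eq e₁ e₂) .bool

/-- `Typed G P` is the judgment `G ⊢ P`: the process `P` is well-typed and uses exactly the qubits
in `G`. The context `G` consists of qubit names and of variables of type qubit, as expressions
(these are the only expressions of type qubit). -/
inductive Typed : Set Expr → Proc → Prop where
  | nil {es : List Expr} (hq : ∀ e ∈ es, e.HasTy .qubit) (hn : es.Nodup) :
      Typed {e | e ∈ es} (.nil es)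
  | tau {G : Set Expr} {t : Tag} {P : Proc} : Typed G P → Typed G (.tau t P)
  | tauPair {G : Set Expr} {t t' : Tag} {P : Proc} : Typed G P → Typed G (.tauPair t t' P)
  | res {G : Set Expr} {P : Proc} {c : Chan} : Typed G P → Typed G (.res P c)
  | sum {G : Set Expr} {P Q : Proc} : Typed G P → Typed G Q → Typed G (.sum P Q)
  | op {G : Set Expr} {t : Tag} {n : ℕ} {E : Superop n} {es : Fin n → Expr} {P : Proc}
      (hpos : 0 < n) (hn : Function.Injective es) (hG : ∀ k, es k ∈ G) :
      Typed G P → Typed G (.op t E es P)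
  | meas {G : Set Expr} {t : Tag} {n : ℕ} {M : Meas n} {es : Fin n → Expr} {y : Var} {P : Proc}
      (hn : Function.Injective es) (hG : ∀ k, es k ∈ G) (hy : y.ty = .nat) :
      Typed G P → Typed G (.meas t M es y P)
  | crecv {G : Set Expr} {t : Tag} {c : Chan} {x : Var} {P : Proc}
      (hc : c.ty ≠ .qubit) (hx : x.ty = c.ty) :
      Typed G P → Typed G (.recv t c x P)
  | qrecv {G : Set Expr} {t : Tag} {c : Chan} {x : Var} {P : Proc}
      (hc : c.ty = .qubit) (hx : x.ty = .qubit) (hG : Expr.var x ∉ G) :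
      Typed (G ∪ {Expr.var x}) P → Typed G (.recv t c x P)
  | qsend {G : Set Expr} {t : Tag} {c : Chan} {e : Expr} {P : Proc}
      (hc : c.ty = .qubit) (he : e.HasTy .qubit) (hG : e ∈ G) :
      Typed (G \ {e}) P → Typed G (.send t c e P)
  | csend {G : Set Expr} {t : Tag} {c : Chan} {e : Expr} {P : Proc}
      (hc : c.ty ≠ .qubit) (he : e.HasTy c.ty) :
      Typed G P → Typed G (.send t c e P)
  | ite {G : Set Expr} {e : Expr} {P Q : Proc} (he : e.HasTy .bool) :
      Typed G P → Typed G Q → Typed G (.ite e P Q)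
  | par {G₁ G₂ : Set Expr} {P Q : Proc} (hd : Disjoint G₁ G₂) :
      Typed G₁ P → Typed G₂ Q → Typed (G₁ ∪ G₂) (.par P Q)

/-- A set of qubit names as a typing context. -/
def ctx (A : Finset Qubit) : Set Expr := {e | ∃ q ∈ A, e = Expr.qubit q}

/-! ## Finitely supported distributions and their liftings -/

/-- `Δ` is a probability distribution with finite support. -/
def IsDist {A : Type*} (Δ : A →₀ ℝ) : Prop :=
  (∀ a, 0 ≤ Δ a) ∧ (Δ.sum fun _ r => r) = 1

/-- The point distribution at `a`. -/
def point {A : Type*} (a : A) : A →₀ ℝ := Finsupp.single a 1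

/-- The distribution `∑ i, p i • Δ i`. -/
def mixture {ι A : Type*} [Fintype ι] (p : ι → ℝ) (Δ : ι → A →₀ ℝ) : A →₀ ℝ :=
  ∑ i, p i • Δ i

/-- The smallest linear relation that contains `(point a, Θ)` whenever `R a Θ`. -/
inductive Lift {A B : Type*} (R : A → (B →₀ ℝ) → Prop) : (A →₀ ℝ) → (B →₀ ℝ) → Prop where
  | point {a : A} {Θ : B →₀ ℝ} : R a Θ → Lift R (point a) Θ
  | mix {Δ₁ Δ₂ : A →₀ ℝ} {Θ₁ Θ₂ : B →₀ ℝ} (p : ℝ) (h0 : 0 ≤ p) (h1 : p ≤ 1) :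
      Lift R Δ₁ Θ₁ → Lift R Δ₂ Θ₂ →
      Lift R (p • Δ₁ + (1 - p) • Δ₂) (p • Θ₁ + (1 - p) • Θ₂)

/-! ## Configurations -/

/-- Operators on the space of the qubits in `S`, as matrices in the computational basis. -/
abbrev State (S : Finset Qubit) : Type := Matrix (S → Fin 2) (S → Fin 2) ℂ

/-- Density operators of trace one. -/
def IsDensity {S : Finset Qubit} (ρ : State S) : Prop := ρ.PosSemidef ∧ ρ.trace = 1

/-- The superoperator that acts as `F` on the qubits `q 0, q 1, …` and as the identity on the
other qubits of `S` (for `q` injective). In coordinates: the matrix entries in which the values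
of the other qubits are kept fixed form an operator on `n` qubits, and `F` is applied to it. -/
def applyOn {S : Finset Qubit} {n : ℕ} (F : Op n →ₗ[ℂ] Op n) (q : Fin n → S) (ρ : State S) :
    State S :=
  Matrix.of fun f g =>
    F (Matrix.of fun a b => ρ (Function.extend q a f) (Function.extend q b g)) (f ∘ q) (g ∘ q)

/-- The pairs `⟨ρ, P⟩`, with the set `S` of the qubits of `ρ`. -/
structure PreConf : Type where
  S : Finset Qubit
  ρ : State S
  P : Proc

/-- `(A, A') ⊢ ⟨ρ, P⟩`: the qubits of `ρ` are `A`, the process has type `A'`, and `A' ⊆ A`. -/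
def PreConf.HasType (A A' : Finset Qubit) (C : PreConf) : Prop :=
  C.S = A ∧ Typed (ctx A') C.P ∧ A' ⊆ A

/-- Configurations of density operators and closed processes that are well-typed. -/
def PreConf.WellTyped (C : PreConf) : Prop :=
  IsDensity C.ρ ∧ C.P.Closed ∧ ∃ A A', C.HasType A A'

/-- `⟨ρ, P⟩ ↦ ⟨ρ, P ∥ Q⟩` -/
def PreConf.parRight (Q : Proc) (C : PreConf) : PreConf := ⟨C.S, C.ρ, .par C.P Q⟩

/-- `⟨ρ, Q⟩ ↦ ⟨ρ, P ∥ Q⟩` -/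
def PreConf.parLeft (P : Proc) (C : PreConf) : PreConf := ⟨C.S, C.ρ, .par P C.P⟩

/-- `⟨ρ, P⟩ ↦ ⟨ρ, P ∖ c⟩` -/
def PreConf.restrict (c : Chan) (C : PreConf) : PreConf := ⟨C.S, C.ρ, .res C.P c⟩

/-! ## Operational semantics -/

/-- Actions `τ`, `c!v`, `c?v`. -/
inductive Act : Type where
  | tau
  | send (c : Chan) (v : Value)
  | recv (c : Chan) (v : Value)

/-- Schedulers `h`, `t`, `(t, t')`. -/
inductive Sched : Type where
  | halt
  | tag (t : Tag)
  | pair (t t' : Tag)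

/-- `μ` is not the reception of a qubit that is owned by `Q`. -/
def Act.Allowed (μ : Act) (Q : Proc) : Prop :=
  ∀ c v, μ = .recv c v → ∀ G, Typed G Q → v.toExpr ∉ G

/-- `Trans ρ P μ s Δ` is the transition from `⟨ρ, P⟩` to `Δ` with action `μ` and scheduler `s`. -/
inductive Trans {S : Finset Qubit} (ρ : State S) :
    Proc → Act → Sched → (PreConf →₀ ℝ) → Prop where
  | iteT {e : Expr} {P Q : Proc} {μ : Act} {s : Sched} {Δ : PreConf →₀ ℝ} :
      e.eval = some (.bool true) → Trans ρ P μ s Δ → Trans ρ (.ite e P Q) μ s Δ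
  | iteF {e : Expr} {P Q : Proc} {μ : Act} {s : Sched} {Δ : PreConf →₀ ℝ} :
      e.eval = some (.bool false) → Trans ρ Q μ s Δ → Trans ρ (.ite e P Q) μ s Δ
  | tau {t : Tag} {P : Proc} :
      Trans ρ (.tau t P) .tau (.tag t) (point ⟨S, ρ, P⟩)
  | tauPair {t t' : Tag} {P : Proc} :
      Trans ρ (.tauPair t t' P) .tau (.pair t t') (point ⟨S, ρ, P⟩)
  | send {t : Tag} {c : Chan} {e : Expr} {v : Value} {P : Proc} :
      e.eval = some v → Trans ρ (.send t c e P) (.send c v) (.tag t) (point ⟨S, ρ, P⟩)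
  | recv {t : Tag} {c : Chan} {x : Var} {v : Value} {P : Proc} (hv : v.ty = c.ty)
      (hS : ∀ q, v = .qubit q → q ∈ S) :
      Trans ρ (.recv t c x P) (.recv c v) (.tag t) (point ⟨S, ρ, P.subst x v⟩)
  | res {P : Proc} {c : Chan} {μ : Act} {s : Sched} {Δ : PreConf →₀ ℝ}
      (hμ : ∀ v, μ ≠ .send c v ∧ μ ≠ .recv c v) :
      Trans ρ P μ s Δ → Trans ρ (.res P c) μ s (Δ.mapDomain (PreConf.restrict c))
  | op {t : Tag} {n : ℕ} {E : Superop n} {es : Fin n → Expr} {P : Proc} (q : Fin n → S)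
      (hq : Function.Injective q) (hes : ∀ k, es k = .qubit (q k)) :
      Trans ρ (.op t E es P) .tau (.tag t) (point ⟨S, applyOn E.map q ρ, P⟩)
  | meas {t : Tag} {n : ℕ} {M : Meas n} {es : Fin n → Expr} {y : Var} {P : Proc} (q : Fin n → S)
      (hq : Function.Injective q) (hes : ∀ k, es k = .qubit (q k)) (p : Fin M.k → ℝ)
      (hp : ∀ m, p m = (applyOn (conjMap (M.M m)) q ρ).trace.re) :
      Trans ρ (.meas t M es y P) .tau (.tag t)
        (mixture p fun m =>
          point ⟨S, (1 / p m) • applyOn (conjMap (M.M m)) q ρ, P.subst y (.nat m)⟩)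
  | parL {P Q : Proc} {μ : Act} {s : Sched} {Δ : PreConf →₀ ℝ} (hμ : μ.Allowed Q) :
      Trans ρ P μ s Δ → Trans ρ (.par P Q) μ s (Δ.mapDomain (PreConf.parRight Q))
  | parR {P Q : Proc} {μ : Act} {s : Sched} {Δ : PreConf →₀ ℝ} (hμ : μ.Allowed P) :
      Trans ρ Q μ s Δ → Trans ρ (.par P Q) μ s (Δ.mapDomain (PreConf.parLeft P))
  | sumL {P Q : Proc} {μ : Act} {s : Sched} {Δ : PreConf →₀ ℝ} :
      Trans ρ P μ s Δ → Trans ρ (.sum P Q) μ s Δ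
  | sumR {P Q : Proc} {μ : Act} {s : Sched} {Δ : PreConf →₀ ℝ} :
      Trans ρ Q μ s Δ → Trans ρ (.sum P Q) μ s Δ
  | synchL {P Q P' Q' : Proc} {c : Chan} {v : Value} {t t' : Tag} :
      Trans ρ P (.send c v) (.tag t) (point ⟨S, ρ, P'⟩) →
      Trans ρ Q (.recv c v) (.tag t') (point ⟨S, ρ, Q'⟩) →
      Trans ρ (.par P Q) .tau (.pair t t') (point ⟨S, ρ, .par P' Q'⟩)
  | synchR {P Q P' Q' : Proc} {c : Chan} {v : Value} {t t' : Tag} :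
      Trans ρ Q (.send c v) (.tag t) (point ⟨S, ρ, Q'⟩) →
      Trans ρ P (.recv c v) (.tag t') (point ⟨S, ρ, P'⟩) →
      Trans ρ (.par P Q) .tau (.pair t t') (point ⟨S, ρ, .par P' Q'⟩)

/-- Transitions of configurations extended with the deadlock `⊥ = none`: a configuration without
a transition for the given action and scheduler moves to `⊥`, and so does `⊥`. -/
inductive BotTrans : Option PreConf → Act → Sched → (Option PreConf →₀ ℝ) → Prop where
  | step {C : PreConf} {μ : Act} {s : Sched} {Δ : PreConf →₀ ℝ} :
      Trans C.ρ C.P μ s Δ → BotTrans (some C) μ s (Δ.mapDomain some)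
  | stuck {C : PreConf} {μ : Act} {s : Sched} :
      (¬ ∃ Δ, Trans C.ρ C.P μ s Δ) → BotTrans (some C) μ s (point none)
  | bot {μ : Act} {s : Sched} : BotTrans none μ s (point none)

/-- Transitions of distributions: `BotTrans` is lifted first to distributions of schedulers and
then to distributions of configurations. -/
def Step (Δ : Option PreConf →₀ ℝ) (μ : Act) (δ : Sched →₀ ℝ) (Δ' : Option PreConf →₀ ℝ) : Prop :=
  Lift (fun C Θ => Lift (fun s Ξ => BotTrans C μ s Ξ) δ Θ) Δ Δ'

/-! ## Deterministic tagging -/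

/-- `Δ` is a distribution over `D` and `⊥`. -/
def IsDistOver (D : Set PreConf) (Δ : Option PreConf →₀ ℝ) : Prop :=
  IsDist Δ ∧ ∀ C : PreConf, Δ (some C) ≠ 0 → C ∈ D

/-- `D` is a set of well-typed configurations that contains their well-typed derivatives (for all
actions), and the evolution of distributions over `D` and `⊥` is determined by the scheduler. -/
def IsDeterministic (D : Set PreConf) : Prop :=
  (∀ C ∈ D, C.WellTyped) ∧
  (∀ C ∈ D, ∀ μ s Δ, Trans C.ρ C.P μ s Δ → (∀ C', Δ C' ≠ 0 → C'.WellTyped) →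
    ∀ C', Δ C' ≠ 0 → C' ∈ D) ∧
  (∀ Δ μ δ Δ' Δ'', IsDistOver D Δ → IsDist δ → IsDistOver D Δ' → IsDistOver D Δ'' →
    Step Δ μ δ Δ' → Step Δ μ δ Δ'' → Δ' = Δ'')

/-- The configurations: those that are well-typed and deterministically tagged. -/
def Conf : Set PreConf := {C | ∃ D, IsDeterministic D ∧ C ∈ D}

/-! ## Saturated bisimilarity -/

/-- `(A, A') ⊢ Δ`; the deadlock has every type. -/
def DistHasType (A A' : Finset Qubit) (Δ : Option PreConf →₀ ℝ) : Prop :=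
  ∀ C : PreConf, Δ (some C) ≠ 0 → C.HasType A A'

/-- The probability of the configurations other than `⊥`. -/
def mass (Δ : Option PreConf →₀ ℝ) : ℝ := 1 - Δ none

/-- Contexts `B[·] = [·] ∥ Q` with a hole of type `A'`, for quantum states on the qubits `A`: the
process `Q` is closed and owns qubits of `A` that are not in `A'`. -/
structure Context (A A' : Finset Qubit) : Type where
  Q : Proc
  closed : Q.Closed
  typed : ∃ A'' : Finset Qubit, A'' ⊆ A ∧ Disjoint A' A'' ∧ Typed (ctx A'') Q

/-- `B[Δ]`, with `B[⊥] = ⊥`. -/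
def Context.apply {A A' : Finset Qubit} (B : Context A A') (Δ : Option PreConf →₀ ℝ) :
    Option PreConf →₀ ℝ :=
  Δ.mapDomain (Option.map (PreConf.parRight B.Q))

/-- Saturated bisimulations. All the distributions involved, `B[Δ]` and `B[Θ]` included, are
distributions over `Conf` and `⊥`. -/
def IsSaturatedBisimulation
    (R : (Option PreConf →₀ ℝ) → (Option PreConf →₀ ℝ) → Prop) : Prop :=
  ∀ Δ Θ, R Δ Θ →
    IsDistOver Conf Δ ∧ IsDistOver Conf Θ ∧
    ∃ A A' : Finset Qubit, DistHasType A A' Δ ∧ DistHasType A A' Θ ∧ mass Δ = mass Θ ∧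
      ∀ B : Context A A', IsDistOver Conf (B.apply Δ) → IsDistOver Conf (B.apply Θ) →
        ∀ δ : Sched →₀ ℝ, IsDist δ →
          (∀ Δ', Step (B.apply Δ) .tau δ Δ' → ∃ Θ', Step (B.apply Θ) .tau δ Θ' ∧ R Δ' Θ') ∧
          (∀ Θ', Step (B.apply Θ) .tau δ Θ' → ∃ Δ', Step (B.apply Δ) .tau δ Δ' ∧ R Δ' Θ')

/-- Saturated bisimilarity: the largest saturated bisimulation. -/
def SaturatedBisimilar (Δ Θ : Option PreConf →₀ ℝ) : Prop :=
  ∃ R, IsSaturatedBisimulation R ∧ R Δ Θ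

end LqCCS

end

/-! A distribution on configurations can be observed only through its aggregate: for each process
and each set of qubits, the sum of the states that occur with that process, weighted by their
probabilities. The two mixtures have equal aggregates, so it suffices that having equal aggregates
and a common type is a saturated bisimulation; this relation is `SameAggregate`.

The reason is linearity. No rule of the semantics consults the entries of ρ to decide whether a
process can move. Hence, by `Trans.uniform`, every τ-transition of P under s comes from a fixed
instrument F (positive linear maps that together preserve the trace) and fixed residual processes,
valid for every density operator on the same qubits. A state σ moves with probability tr (F m σ) to
the normalized F m σ; in the aggregate the probability cancels the normalization
(`aggregate_outcome`), and what remains is linear in σ.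

Deterministic tagging makes the resulting distribution independent of the chosen instrument
(`eq_evolve_of_botTrans`). So a τ-step over `Conf` is a function of the distribution and the
scheduler, and `aggregate_bind_evolve` gives the aggregate after the step as a linear image of the
aggregate before it. A parallel context only relabels processes (`aggregate_apply`). Deadlock
contributes nothing to the aggregate, but its probability is recovered from traces
(`mass_eq_aggregate`).

Determinism is only assumed between well-typed derivatives, so subject reduction
(`IsUniform.wellTyped`) is needed as well. It rests on the linear substitution lemma `Typed.subst`
and on the transfer of ownership in `VisibleTyping.synch`. -/

namespace LqCCS

/-! ## Local operators and instruments -/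

open scoped Kronecker

section LocalOperators

variable {S : Finset Qubit} {n : ℕ}

/-- An assignment of the qubits in `S` splits into the values at `q` and the other values. -/
noncomputable def splitEquiv (q : Fin n → S) (hq : Function.Injective q) :
    (S → Fin 2) ≃ (Fin n → Fin 2) × ({s // s ∉ Set.range q} → Fin 2) where
  toFun f := (f ∘ q, fun s => f s)
  -- The default 0 is never read: the fallback of `Function.extend` is consulted only off the range
  -- of `q`.
  invFun x := Function.extend q x.1 fun s => if h : s ∉ Set.range q then x.2 ⟨s, h⟩ else 0
  left_inv f := by
    funext s
    by_cases hs : s ∈ Set.range q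
    · obtain ⟨k, rfl⟩ := hs
      simp [hq.extend_apply]
    · have hs' : ¬ ∃ k, q k = s := hs
      simp only [Function.extend_apply' _ _ _ hs', dif_pos hs]
  right_inv x := by
    refine Prod.ext ?_ ?_
    · funext k
      simp [hq.extend_apply]
    · funext s
      have hs : ¬ ∃ k, q k = s := by simpa using s.2
      simp only
      rw [Function.extend_apply' _ _ _ hs, dif_pos s.2]

theorem splitEquiv_symm_apply (q : Fin n → S) (hq : Function.Injective q) (a : Fin n → Fin 2)
    (f : S → Fin 2) : (splitEquiv q hq).symm (a, fun s => f s) = Function.extend q a f := by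
  rw [Equiv.symm_apply_eq]
  refine Prod.ext ?_ ?_
  · funext k
    simp [splitEquiv, hq.extend_apply]
  · funext s
    have hs : ¬ ∃ k, q k = s := by simpa using s.2
    simp [splitEquiv, Function.extend_apply' _ _ _ hs]

/-- The operator that acts as `K` on the qubits `q` and as the identity on the others. -/
noncomputable def localOp (q : Fin n → S) (hq : Function.Injective q) (K : Op n) : State S :=
  (K ⊗ₖ (1 : Matrix ({s // s ∉ Set.range q} → Fin 2) _ ℂ)).submatrix
    (splitEquiv q hq) (splitEquiv q hq)

theorem localOp_apply (q : Fin n → S) (hq : Function.Injective q) (K : Op n) (f g : S → Fin 2) :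
    localOp q hq K f g = K (f ∘ q) (g ∘ q) *
      (1 : Matrix ({s // s ∉ Set.range q} → Fin 2) ({s // s ∉ Set.range q} → Fin 2) ℂ)
        (fun s => f s) (fun s => g s) := rfl

/-- The identity factor kills every summand that changes a qubit outside `q`, so only the
assignments `Function.extend q a f` survive, which are the ones used by `applyOn`. -/
theorem localOp_mul_apply (q : Fin n → S) (hq : Function.Injective q) (K : Op n) (X : State S)
    (f g : S → Fin 2) :
    (localOp q hq K * X) f g = ∑ a, K (f ∘ q) a * X (Function.extend q a f) g := by
  classical
  rw [Matrix.mul_apply, ← Equiv.sum_comp (splitEquiv q hq).symm, Fintype.sum_prod_type]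
  refine Finset.sum_congr rfl fun a _ => ?_
  rw [Finset.sum_eq_single fun s : {s // s ∉ Set.range q} => f s]
  · have h1 : Function.extend q a f ∘ q = a := funext fun k => hq.extend_apply _ _ _
    have h2 : (fun s : {s // s ∉ Set.range q} => Function.extend q a f s) =
        fun s : {s // s ∉ Set.range q} => f s :=
      funext fun s => Function.extend_apply' _ _ _ s.2
    rw [splitEquiv_symm_apply, localOp_apply, h1, h2, Matrix.one_apply_eq, mul_one]
  · intro c _ hc
    have h1 : (1 : Matrix ({s // s ∉ Set.range q} → Fin 2) _ ℂ) (fun s => f s) c = 0 :=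
      Matrix.one_apply_ne (Ne.symm hc)
    have h2 : localOp q hq K f ((splitEquiv q hq).symm (a, c)) = 0 := by
      rw [localOp, Matrix.submatrix_apply, Equiv.apply_symm_apply, Matrix.kroneckerMap_apply]
      change _ * (1 : Matrix ({s // s ∉ Set.range q} → Fin 2) _ ℂ) (fun s => f s) c = 0
      rw [h1, mul_zero]
    rw [h2, zero_mul]
  · simp

theorem mul_conjTranspose_localOp_apply (q : Fin n → S) (hq : Function.Injective q) (K : Op n)
    (X : State S) (f g : S → Fin 2) :
    (X * (localOp q hq K).conjTranspose) f g =
      ∑ b, X f (Function.extend q b g) * star (K (g ∘ q) b) := by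
  have h := localOp_mul_apply q hq K X.conjTranspose g f
  rw [← Matrix.conjTranspose_conjTranspose (X * _), Matrix.conjTranspose_apply,
    Matrix.conjTranspose_mul, Matrix.conjTranspose_conjTranspose, h, star_sum]
  refine Finset.sum_congr rfl fun b _ => ?_
  rw [star_mul', Matrix.conjTranspose_apply, star_star, mul_comm]

/-- Turns the entrywise definition of `applyOn` into a conjugation, so that positivity and traces
follow from matrix algebra. -/
theorem applyOn_conjMap (q : Fin n → S) (hq : Function.Injective q) (K : Op n) (ρ : State S) :
    applyOn (conjMap K) q ρ = localOp q hq K * ρ * (localOp q hq K).conjTranspose := by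
  ext f g
  rw [Matrix.mul_assoc, localOp_mul_apply]
  simp_rw [mul_conjTranspose_localOp_apply]
  simp [applyOn, conjMap, Matrix.mul_apply]

theorem conjTranspose_localOp_mul (q : Fin n → S) (hq : Function.Injective q) (K : Op n) :
    (localOp q hq K).conjTranspose * localOp q hq K = localOp q hq (K.conjTranspose * K) := by
  rw [localOp, Matrix.conjTranspose_submatrix, Matrix.submatrix_mul_equiv,
    Matrix.conjTranspose_kronecker, ← Matrix.mul_kronecker_mul]
  simp [localOp]

/-- K ↦ K ⊗ 1 is additive and unital and respects adjoints and products, so completeness survives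
the extension to all of `S`. -/
theorem sum_conjTranspose_localOp_mul {κ : Type*} [Fintype κ] (q : Fin n → S)
    (hq : Function.Injective q) (K : κ → Op n) (h : ∑ i, (K i).conjTranspose * K i = 1) :
    ∑ i, (localOp q hq (K i)).conjTranspose * localOp q hq (K i) = 1 := by
  have hsum : ∑ i, localOp q hq ((K i).conjTranspose * K i) =
      localOp q hq (∑ i, (K i).conjTranspose * K i) := by
    ext f g
    simp [localOp, Matrix.sum_apply, Finset.sum_mul, Matrix.kroneckerMap_apply]
  simp_rw [conjTranspose_localOp_mul]
  rw [hsum, h, localOp, Matrix.one_kronecker_one, Matrix.submatrix_one_equiv]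

theorem sum_trace_applyOn_conjMap {κ : Type*} [Fintype κ] (q : Fin n → S)
    (hq : Function.Injective q) (K : κ → Op n) (h : ∑ i, (K i).conjTranspose * K i = 1)
    (ρ : State S) : ∑ i, (applyOn (conjMap (K i)) q ρ).trace = ρ.trace := by
  simp_rw [applyOn_conjMap q hq, Matrix.mul_assoc, Matrix.trace_mul_comm (localOp q hq _),
    Matrix.mul_assoc]
  rw [← Matrix.trace_sum, ← Matrix.mul_sum, sum_conjTranspose_localOp_mul q hq K h, Matrix.mul_one]

theorem posSemidef_applyOn_conjMap (q : Fin n → S) (hq : Function.Injective q) (K : Op n)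
    {ρ : State S} (hρ : ρ.PosSemidef) : (applyOn (conjMap K) q ρ).PosSemidef := by
  rw [applyOn_conjMap q hq]
  exact hρ.mul_mul_conjTranspose_same _

/-- `applyOn F q` as a linear map. -/
noncomputable def applyOnLinear (F : Op n →ₗ[ℂ] Op n) (q : Fin n → S) :
    State S →ₗ[ℂ] State S where
  toFun := applyOn F q
  map_add' ρ σ := by
    ext f g
    simp only [applyOn, Matrix.of_apply, Matrix.add_apply]
    rw [← Matrix.add_apply, ← map_add]
    rfl
  map_smul' c ρ := by
    ext f g
    simp only [applyOn, Matrix.of_apply, Matrix.smul_apply, RingHom.id_apply]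
    rw [← Matrix.smul_apply, ← map_smul]
    rfl

theorem Superop.applyOn_eq_sum (E : Superop n) :
    ∃ K : Fin ((2 ^ n) ^ 2) → Op n, (∑ i, (K i).conjTranspose * K i = 1) ∧
      ∀ (q : Fin n → S) (ρ : State S),
        applyOn E.map q ρ = ∑ i, applyOn (conjMap (K i)) q ρ := by
  obtain ⟨K, hK, hE⟩ := E.kraus
  refine ⟨K, hK, fun q ρ => ?_⟩
  ext f g
  simp [applyOn, hE, Matrix.sum_apply, conjMap, Matrix.mul_assoc]

/-! ### Instruments and their outcome probabilities. -/

/-- A family of positive maps that together preserve the trace. -/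
structure IsInstrument {k : ℕ} (F : Fin k → State S →ₗ[ℂ] State S) : Prop where
  posSemidef : ∀ m σ, σ.PosSemidef → (F m σ).PosSemidef
  trace : ∀ σ, ∑ m, (F m σ).trace = σ.trace

theorem isInstrument_id : IsInstrument fun _ : Fin 1 => (LinearMap.id : State S →ₗ[ℂ] State S) :=
  ⟨fun _ _ h => h, fun _ => by simp⟩

theorem isInstrument_superop (E : Superop n) (q : Fin n → S) (hq : Function.Injective q) :
    IsInstrument fun _ : Fin 1 => applyOnLinear E.map q := by
  obtain ⟨K, hK, hE⟩ := E.applyOn_eq_sum (S := S)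
  refine ⟨fun _ σ hσ => ?_, fun σ => ?_⟩
  · change (applyOn E.map q σ).PosSemidef
    rw [hE]
    exact Matrix.posSemidef_sum _ fun i _ => posSemidef_applyOn_conjMap q hq _ hσ
  · change ∑ _ : Fin 1, (applyOn E.map q σ).trace = _
    rw [hE, Matrix.trace_sum, sum_trace_applyOn_conjMap q hq K hK]
    simp

theorem isInstrument_meas (M : Meas n) (q : Fin n → S) (hq : Function.Injective q) :
    IsInstrument fun m => applyOnLinear (conjMap (M.M m)) q :=
  ⟨fun m _ hσ => posSemidef_applyOn_conjMap q hq (M.M m) hσ,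
    fun σ => sum_trace_applyOn_conjMap q hq M.M M.complete σ⟩

/-- The probability of the outcome `m` of an instrument. -/
noncomputable def outcomeProb {k : ℕ} (F : Fin k → State S →ₗ[ℂ] State S) (σ : State S)
    (m : Fin k) : ℝ := (F m σ).trace.re

namespace IsInstrument

variable {k : ℕ} {F : Fin k → State S →ₗ[ℂ] State S} (hF : IsInstrument F) {σ : State S}
include hF

theorem trace_eq (hσ : σ.PosSemidef) (m : Fin k) : (F m σ).trace = (outcomeProb F σ m : ℂ) := by
  have h := (hF.posSemidef m σ hσ).trace_nonneg
  exact Complex.eq_re_of_ofReal_le (r := 0) (by simpa using h)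

theorem outcomeProb_nonneg (hσ : σ.PosSemidef) (m : Fin k) : 0 ≤ outcomeProb F σ m :=
  (Complex.nonneg_iff.mp (hF.posSemidef m σ hσ).trace_nonneg).1

theorem sum_outcomeProb (hσ : IsDensity σ) : ∑ m, outcomeProb F σ m = 1 := by
  have h := congrArg Complex.re (hF.trace σ)
  rw [hσ.2, Complex.re_sum] at h
  exact h

/-- This cancellation makes the aggregated evolution linear. It survives probability 0, where `1 / 0
= 0`, because a positive semidefinite operator of trace 0 vanishes. -/
theorem smul_normalized (hσ : σ.PosSemidef) (m : Fin k) :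
    outcomeProb F σ m • (1 / outcomeProb F σ m) • F m σ = F m σ := by
  by_cases h : outcomeProb F σ m = 0
  · have h0 : F m σ = 0 := by
      rw [← (hF.posSemidef m σ hσ).trace_eq_zero_iff, hF.trace_eq hσ, h, Complex.ofReal_zero]
    simp [h0]
  · rw [smul_smul, mul_one_div_cancel h, one_smul]

theorem isDensity_normalized (hσ : σ.PosSemidef) {m : Fin k} (h : outcomeProb F σ m ≠ 0) :
    IsDensity ((1 / outcomeProb F σ m) • F m σ) := by
  constructor
  · exact (hF.posSemidef m σ hσ).smul
      (one_div_nonneg.mpr (hF.outcomeProb_nonneg hσ m))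
  · rw [Matrix.trace_smul, hF.trace_eq hσ, Complex.real_smul, ← Complex.ofReal_mul,
      one_div_mul_cancel h, Complex.ofReal_one]

end IsInstrument

end LocalOperators

/-! ## Typing and substitution -/

theorem Expr.HasTy.qubit_cases {e : Expr} (h : e.HasTy .qubit) :
    (∃ x : Var, x.ty = .qubit ∧ e = .var x) ∨ ∃ q, e = .qubit q := by
  generalize hT : Ty.qubit = T at h
  cases h with
  | var x => exact Or.inl ⟨x, rfl, rfl⟩
  | qubit q => exact Or.inr ⟨q, rfl⟩
  | _ => cases hT

/-- Compound expressions are boolean, so an expression of type qubit that has a value is a qubit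
name already. Thus the expression sent and the value received are the same element of a typing
context. -/
theorem Expr.HasTy.eq_toExpr {e : Expr} {v : Value} (h : e.HasTy .qubit) (hv : e.eval = some v) :
    e = v.toExpr := by
  obtain ⟨x, -, rfl⟩ | ⟨q, rfl⟩ := h.qubit_cases
  · simp [Expr.eval] at hv
  · simp only [Expr.eval, Option.some.injEq] at hv
    subst hv
    rfl

theorem Value.toExpr_hasTy (v : Value) : v.toExpr.HasTy v.ty := by
  cases v <;> constructor

theorem Expr.HasTy.subst {e : Expr} {T : Ty} {x : Var} {v : Value} (hv : v.ty = x.ty)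
    (h : e.HasTy T) : (e.subst x v).HasTy T := by
  induction h with
  | var y =>
    simp only [Expr.subst]
    split
    · next hy =>
      subst hy
      rw [← hv]
      exact v.toExpr_hasTy
    · exact .var y
  | bool b => exact .bool b
  | nat n => exact .nat n
  | qubit q => exact .qubit q
  | not _ ih => exact .not ih
  | or _ _ ih₁ ih₂ => exact .or ih₁ ih₂
  | le _ _ ih₁ ih₂ => exact .le ih₁ ih₂
  | eq _ _ ih₁ ih₂ => exact .eq ih₁ ih₂

theorem Typed.hasTy_qubit {G : Set Expr} {P : Proc} (h : Typed G P) :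
    ∀ e ∈ G, e.HasTy .qubit := by
  induction h with
  | nil hq _ => exact hq
  | qrecv _ _ _ _ ih => exact fun e he => ih e (Or.inl he)
  | @qsend G t c e₀ P _ he₀ _ _ ih =>
    intro e he
    by_cases h : e = e₀
    · exact h ▸ he₀
    · exact ih e ⟨he, h⟩
  | ite _ _ _ ih _ => exact ih
  | par _ _ _ ih₁ ih₂ => exact fun e he => he.elim (ih₁ e) (ih₂ e)
  | sum _ _ ih _ => exact ih
  | _ => assumption

theorem Expr.subst_eq_self_of_qubit {e : Expr} (h : e.HasTy .qubit) {x : Var} (v : Value)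
    (hx : e ≠ .var x) : e.subst x v = e := by
  obtain ⟨y, -, rfl⟩ | ⟨q, rfl⟩ := h.qubit_cases
  · simp only [ne_eq, Expr.var.injEq] at hx
    simp [Expr.subst, hx]
  · rfl

theorem image_subst_eq_self {G : Set Expr} (hG : ∀ e ∈ G, e.HasTy .qubit) {x : Var} (v : Value)
    (hx : Expr.var x ∉ G) : Expr.subst x v '' G = G := by
  have h : ∀ e ∈ G, e.subst x v = e := fun e he =>
    Expr.subst_eq_self_of_qubit (hG e he) v fun h => hx (h ▸ he)
  rw [Set.image_congr h, Set.image_id']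

/-- Injectivity on the context is what linearity requires: a substitution that identified two owned
qubits would break the distinctness of arguments and the disjointness of parallel components. -/
theorem Typed.subst {G : Set Expr} {P : Proc} {x : Var} {v : Value} (hv : v.ty = x.ty)
    (h : Typed G P) (hinj : Set.InjOn (Expr.subst x v) G) :
    Typed (Expr.subst x v '' G) (P.subst x v) := by
  induction h with
  | @nil es hq hn =>
    have hmap : Expr.subst x v '' {e | e ∈ es} = {e | e ∈ es.map (Expr.subst x v)} := by
      ext e
      simp
    rw [hmap]
    refine .nil (fun e he => ?_) (hn.map_on fun a ha b hb hab => hinj ha hb hab)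
    obtain ⟨e', he', rfl⟩ := List.mem_map.mp he
    exact (hq e' he').subst hv
  | tau _ ih => exact .tau (ih hinj)
  | tauPair _ ih => exact .tauPair (ih hinj)
  | res _ ih => exact .res (ih hinj)
  | sum _ _ ih₁ ih₂ => exact .sum (ih₁ hinj) (ih₂ hinj)
  | op hpos hn hG _ ih =>
    exact .op hpos (fun a b hab => hn (hinj (hG a) (hG b) hab))
      (fun k => Set.mem_image_of_mem _ (hG k)) (ih hinj)
  | @meas G t n M es y P hn hG hy hP ih =>
    refine .meas (fun a b hab => hn (hinj (hG a) (hG b) hab))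
      (fun k => Set.mem_image_of_mem _ (hG k)) hy ?_
    split
    -- The binder shadows `x`, so the body is unchanged. The context must then be unchanged too: `x`
    -- has type nat here and cannot belong to it.
    · next hyx =>
      subst hyx
      rw [image_subst_eq_self hP.hasTy_qubit v]
      · exact hP
      · intro hmem
        obtain ⟨z, hz, hyz⟩ | ⟨q, hq⟩ := (hP.hasTy_qubit _ hmem).qubit_cases
        · simp only [Expr.var.injEq] at hyz
          rw [← hyz, hy] at hz
          cases hz
        · cases hq
    · exact ih hinj
  | @crecv G t c y P hc hy hP ih =>
    refine .crecv hc hy ?_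
    split
    · next hyx =>
      subst hyx
      rw [image_subst_eq_self hP.hasTy_qubit v]
      · exact hP
      · intro hmem
        obtain ⟨z, hz, hyz⟩ | ⟨q, hq⟩ := (hP.hasTy_qubit _ hmem).qubit_cases
        · simp only [Expr.var.injEq] at hyz
          rw [← hyz, hy] at hz
          exact hc hz
        · cases hq
    · exact ih hinj
  | @qrecv G t c y P hc hy hG hP ih =>
    have hGq : ∀ e ∈ G, e.HasTy .qubit := fun e he => hP.hasTy_qubit e (Or.inl he)
    by_cases hyx : y = x
    · subst hyx
      rw [image_subst_eq_self hGq v hG]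
      simp only [Proc.subst, if_true]
      exact .qrecv hc hy hG hP
    -- A value is not a variable and the other elements of `G` are fixed, so the bound variable
    -- stays fresh. This also extends injectivity to the enlarged context.
    · have hne : ∀ e ∈ G, e.subst x v ≠ .var y := by
        intro e he heq
        by_cases hex : e = .var x
        · subst hex
          simp only [Expr.subst, if_true] at heq
          cases v <;> cases heq
        · rw [Expr.subst_eq_self_of_qubit (hGq e he) v hex] at heq
          exact hG (heq ▸ he)
      have hself : (Expr.var y).subst x v = .var y := by simp [Expr.subst, hyx]
      simp only [Proc.subst, if_neg hyx]
      refine .qrecv hc hy (fun ⟨e, he, heq⟩ => hne e he heq) ?_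
      have himg := ih (by
        rw [Set.union_singleton]
        refine (Set.injOn_insert hG).mpr ⟨hinj, ?_⟩
        rintro ⟨e, he, heq⟩
        exact hne e he (heq.trans hself))
      rwa [Set.image_union, Set.image_singleton, hself] at himg
  | @qsend G t c e P hc he hG hP ih =>
    refine .qsend hc (he.subst hv) (Set.mem_image_of_mem _ hG) ?_
    have himg := ih (hinj.mono Set.sdiff_subset)
    rwa [hinj.image_sdiff_subset (Set.singleton_subset_iff.mpr hG), Set.image_singleton] at himg
  | csend hc he _ ih => exact .csend hc (he.subst hv) (ih hinj)
  | ite he _ _ ih₁ ih₂ => exact .ite (he.subst hv) (ih₁ hinj) (ih₂ hinj)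
  | @par G₁ G₂ P Q hd _ _ ih₁ ih₂ =>
    rw [Set.image_union]
    refine .par ?_ (ih₁ (hinj.mono Set.subset_union_left))
      (ih₂ (hinj.mono Set.subset_union_right))
    rw [Set.disjoint_left]
    rintro _ ⟨a, ha, rfl⟩ ⟨b, hb, hab⟩
    have := hinj (Or.inr hb) (Or.inl ha) hab
    exact Set.disjoint_left.mp hd ha (this ▸ hb)

/-- Contexts contain no variables of classical type, so such a substitution fixes the context
pointwise. -/
theorem Typed.subst_classical {G : Set Expr} {P : Proc} {x : Var} {v : Value} (hv : v.ty = x.ty)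
    (hx : x.ty ≠ .qubit) (h : Typed G P) : Typed G (P.subst x v) := by
  have hself : ∀ e ∈ G, e.subst x v = e := fun e he => by
    refine Expr.subst_eq_self_of_qubit (h.hasTy_qubit e he) v ?_
    rintro rfl
    obtain ⟨z, hz, hxz⟩ | ⟨q, hq⟩ := (h.hasTy_qubit _ he).qubit_cases
    · simp only [Expr.var.injEq] at hxz
      exact hx (hxz ▸ hz)
    · cases hq
  have himg := h.subst hv fun a ha b hb hab => by rwa [hself a ha, hself b hb] at hab
  rwa [Set.image_congr hself, Set.image_id'] at himg

/-- The received name is not yet owned; this is what makes the substitution injective on the context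
with `x`. -/
theorem Typed.subst_qubit {G : Set Expr} {P : Proc} {x : Var} {v : Value} (hv : v.ty = x.ty)
    (hxG : Expr.var x ∉ G) (hvG : v.toExpr ∉ G) (h : Typed (G ∪ {Expr.var x}) P) :
    Typed (G ∪ {v.toExpr}) (P.subst x v) := by
  have hGq : ∀ e ∈ G, e.HasTy .qubit := fun e he => h.hasTy_qubit e (Or.inl he)
  have hself : ∀ e ∈ G, e.subst x v = e := fun e he =>
    Expr.subst_eq_self_of_qubit (hGq e he) v fun h => hxG (h ▸ he)
  have hx : (Expr.var x).subst x v = v.toExpr := by simp [Expr.subst]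
  have himg := h.subst hv (by
    rw [Set.union_singleton]
    refine (Set.injOn_insert hxG).mpr ⟨fun a ha b hb hab => ?_, ?_⟩
    · rwa [hself a ha, hself b hb] at hab
    · rintro ⟨e, he, heq⟩
      rw [hself e he, hx] at heq
      exact hvG (heq ▸ he))
  rwa [Set.image_union, Set.image_singleton, hx, Set.image_congr hself, Set.image_id'] at himg

/-! ### Free variables under substitution. -/

theorem Value.freeVars_toExpr (v : Value) : v.toExpr.freeVars = ∅ := by
  cases v <;> rfl

theorem Expr.freeVars_subst_subset (x : Var) (v : Value) (e : Expr) :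
    (e.subst x v).freeVars ⊆ e.freeVars \ {x} := by
  induction e with
  | var y =>
    simp only [Expr.subst]
    split
    · simp [Value.freeVars_toExpr]
    · next h => simpa [Expr.freeVars] using h
  | not e ih => exact ih
  | or e₁ e₂ ih₁ ih₂ | le e₁ e₂ ih₁ ih₂ | eq e₁ e₂ ih₁ ih₂ =>
    rintro y (hy | hy)
    · exact ⟨Or.inl (ih₁ hy).1, (ih₁ hy).2⟩
    · exact ⟨Or.inr (ih₂ hy).1, (ih₂ hy).2⟩
  | _ => exact Set.empty_subset _

theorem Proc.freeVars_subst_subset (x : Var) (v : Value) (P : Proc) :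
    (P.subst x v).freeVars ⊆ P.freeVars \ {x} := by
  induction P with
  | tau t P ih => exact ih
  | tauPair t t' P ih => exact ih
  | res P c ih => exact ih
  | op t E es P ih =>
    rintro y (hy | hy)
    · obtain ⟨k, hk⟩ := Set.mem_iUnion.mp hy
      have := Expr.freeVars_subst_subset x v _ hk
      exact ⟨Or.inl (Set.mem_iUnion.mpr ⟨k, this.1⟩), this.2⟩
    · exact ⟨Or.inr (ih hy).1, (ih hy).2⟩
  | meas t M es z P ih =>
    rintro y (hy | ⟨hy, hyz⟩)
    · obtain ⟨k, hk⟩ := Set.mem_iUnion.mp hy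
      have := Expr.freeVars_subst_subset x v _ hk
      exact ⟨Or.inl (Set.mem_iUnion.mpr ⟨k, this.1⟩), this.2⟩
    · split at hy
      · next h => exact ⟨Or.inr ⟨hy, hyz⟩, h ▸ hyz⟩
      · exact ⟨Or.inr ⟨(ih hy).1, hyz⟩, (ih hy).2⟩
  | recv t c z P ih =>
    rintro y ⟨hy, hyz⟩
    split at hy
    · next h => exact ⟨⟨hy, hyz⟩, h ▸ hyz⟩
    · exact ⟨⟨(ih hy).1, hyz⟩, (ih hy).2⟩
  | nil es =>
    rintro y ⟨e, he, hy⟩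
    obtain ⟨e', he', rfl⟩ := List.mem_map.mp he
    have := Expr.freeVars_subst_subset x v _ hy
    exact ⟨⟨e', he', this.1⟩, this.2⟩
  | send t c e P ih =>
    rintro y (hy | hy)
    · have := Expr.freeVars_subst_subset x v _ hy
      exact ⟨Or.inl this.1, this.2⟩
    · exact ⟨Or.inr (ih hy).1, (ih hy).2⟩
  | ite e P Q ihP ihQ =>
    rintro y ((hy | hy) | hy)
    · have := Expr.freeVars_subst_subset x v _ hy
      exact ⟨Or.inl (Or.inl this.1), this.2⟩
    · exact ⟨Or.inl (Or.inr (ihP hy).1), (ihP hy).2⟩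
    · exact ⟨Or.inr (ihQ hy).1, (ihQ hy).2⟩
  | sum P Q ihP ihQ | par P Q ihP ihQ =>
    rintro y (hy | hy)
    · exact ⟨Or.inl (ihP hy).1, (ihP hy).2⟩
    · exact ⟨Or.inr (ihQ hy).1, (ihQ hy).2⟩

/-! ## Transitions are uniform in the quantum state -/

section Mixtures

variable {A B : Type*}

theorem mapDomain_point (f : A → B) (a : A) : (point a).mapDomain f = point (f a) :=
  Finsupp.mapDomain_single

theorem mapDomain_mixture {ι : Type*} [Fintype ι] (f : A → B) (p : ι → ℝ) (Δ : ι → A →₀ ℝ) :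
    (mixture p Δ).mapDomain f = mixture p fun i => (Δ i).mapDomain f := by
  rw [mixture, mixture, Finsupp.mapDomain_finsetSum]
  exact Finset.sum_congr rfl fun i _ => Finsupp.mapDomain_smul _ _

theorem point_injective : Function.Injective (point : A → A →₀ ℝ) :=
  Finsupp.single_left_injective one_ne_zero

end Mixtures

/-! ### Transitions with a visible action, and synchronization. -/

/-- The typing of the residual process after the emission or the reception of a value. -/
def VisibleTyping (P : Proc) (P' : Proc) : Act → Prop
  | .tau => False
  | .send c v => ∀ G, Typed G P →
      (c.ty = .qubit → v.toExpr ∈ G ∧ Typed (G \ {v.toExpr}) P') ∧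
      (c.ty ≠ .qubit → Typed G P')
  | .recv c v => ∀ G, Typed G P →
      (c.ty = .qubit → v.toExpr ∉ G → Typed (G ∪ {v.toExpr}) P') ∧
      (c.ty ≠ .qubit → Typed G P')

theorem VisibleTyping.of_imp {P Q P' : Proc} {μ : Act} (h : VisibleTyping P P' μ)
    (hPQ : ∀ G, Typed G Q → Typed G P) : VisibleTyping Q P' μ := by
  cases μ with
  | tau => exact h
  | send c v => exact fun G hG => h G (hPQ G hG)
  | recv c v => exact fun G hG => h G (hPQ G hG)

theorem VisibleTyping.res {P P' : Proc} {μ : Act} (c : Chan) (h : VisibleTyping P P' μ) :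
    VisibleTyping (.res P c) (.res P' c) μ := by
  cases μ with
  | tau => exact h
  | send d v =>
    intro G hG
    cases hG with
    | res hG =>
      exact ⟨fun hd => ⟨((h G hG).1 hd).1, .res ((h G hG).1 hd).2⟩, fun hd => .res ((h G hG).2 hd)⟩
  | recv d v =>
    intro G hG
    cases hG with
    | res hG =>
      exact ⟨fun hd hv => .res ((h G hG).1 hd hv), fun hd => .res ((h G hG).2 hd)⟩

theorem VisibleTyping.parL {P P' : Proc} {μ : Act} (Q : Proc) (h : VisibleTyping P P' μ) :
    VisibleTyping (.par P Q) (.par P' Q) μ := by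
  cases μ with
  | tau => exact h
  | send d v =>
    intro G hG
    cases hG with
    | @par G₁ G₂ _ _ hdis h₁ h₂ =>
      refine ⟨fun hd => ?_, fun hd => .par hdis ((h _ h₁).2 hd) h₂⟩
      obtain ⟨hv, hP'⟩ := (h _ h₁).1 hd
      refine ⟨Or.inl hv, ?_⟩
      rw [Set.union_sdiff_distrib,
        Set.sdiff_singleton_eq_self (Set.disjoint_left.mp hdis hv)]
      exact .par (hdis.mono_left Set.sdiff_subset) hP' h₂
  | recv d v =>
    intro G hG
    cases hG with
    | @par G₁ G₂ _ _ hdis h₁ h₂ =>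
      refine ⟨fun hd hv => ?_, fun hd => .par hdis ((h _ h₁).2 hd) h₂⟩
      rw [Set.union_right_comm]
      exact .par (Set.disjoint_union_left.mpr
        ⟨hdis, Set.disjoint_singleton_left.mpr fun h' => hv (Or.inr h')⟩)
        ((h _ h₁).1 hd fun h' => hv (Or.inl h')) h₂

theorem Typed.par_comm {G : Set Expr} {P Q : Proc} (h : Typed G (.par P Q)) :
    Typed G (.par Q P) := by
  cases h with
  | par hd hP hQ =>
    rw [Set.union_comm]
    exact .par hd.symm hQ hP

theorem VisibleTyping.parR {Q Q' : Proc} {μ : Act} (P : Proc) (h : VisibleTyping Q Q' μ) :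
    VisibleTyping (.par P Q) (.par P Q') μ := by
  have h' := (h.parL P).of_imp fun G hG => Typed.par_comm (P := P) (Q := Q) hG
  cases μ with
  | tau => exact h'
  | send d v =>
    exact fun G hG => ⟨fun hd => ⟨((h' G hG).1 hd).1, ((h' G hG).1 hd).2.par_comm⟩,
      fun hd => ((h' G hG).2 hd).par_comm⟩
  | recv d v =>
    exact fun G hG => ⟨fun hd hv => ((h' G hG).1 hd hv).par_comm,
      fun hd => ((h' G hG).2 hd).par_comm⟩

/-- Inputs and outputs neither touch the quantum state nor branch, and their side conditions mention
at most the set of qubits. Hence the same residual serves every state, which is what the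
synchronization rules need. -/
theorem Trans.visible {S : Finset Qubit} {ρ : State S} {P : Proc} {μ : Act} {s : Sched}
    {Δ : PreConf →₀ ℝ} (h : Trans ρ P μ s Δ) (hμ : μ ≠ .tau) :
    ∃ P', Δ = point ⟨S, ρ, P'⟩ ∧ (∀ σ : State S, Trans σ P μ s (point ⟨S, σ, P'⟩)) ∧
      P'.freeVars ⊆ P.freeVars ∧ VisibleTyping P P' μ := by
  induction h with
  | iteT he _ ih =>
    obtain ⟨P', rfl, hσ, hfv, hty⟩ := ih hμ
    refine ⟨P', rfl, fun σ => .iteT he (hσ σ), fun x hx => Or.inl (Or.inr (hfv hx)),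
      hty.of_imp fun G hG => ?_⟩
    cases hG; assumption
  | iteF he _ ih =>
    obtain ⟨P', rfl, hσ, hfv, hty⟩ := ih hμ
    refine ⟨P', rfl, fun σ => .iteF he (hσ σ), fun x hx => Or.inr (hfv hx),
      hty.of_imp fun G hG => ?_⟩
    cases hG; assumption
  | @send t c e v P he =>
    refine ⟨P, rfl, fun σ => .send he, fun x hx => Or.inr hx, fun G hG => ?_⟩
    cases hG with
    | qsend hc heq hG hP =>
      have hev := heq.eq_toExpr he
      subst hev
      exact ⟨fun _ => ⟨hG, hP⟩, fun h => absurd hc h⟩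
    | csend hc _ hP => exact ⟨fun h => absurd h hc, fun _ => hP⟩
  | @recv t c x v P hv hS =>
    refine ⟨P.subst x v, rfl, fun σ => .recv hv hS, P.freeVars_subst_subset x v, fun G hG => ?_⟩
    cases hG with
    | qrecv hc hx hG hP =>
      exact ⟨fun _ hvG => hP.subst_qubit (hv.trans (hc.trans hx.symm)) hG hvG,
        fun h => absurd hc h⟩
    | crecv hc hx hP =>
      exact ⟨fun h => absurd h hc, fun _ => hP.subst_classical (hv.trans hx.symm) (hx ▸ hc)⟩
  | @res P c μ s Δ hcμ _ ih =>
    obtain ⟨P', rfl, hσ, hfv, hty⟩ := ih hμ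
    refine ⟨.res P' c, mapDomain_point _ _, fun σ => ?_, hfv, hty.res c⟩
    have h := Trans.res hcμ (hσ σ)
    rwa [mapDomain_point] at h
  | @parL P Q μ s Δ hall _ ih =>
    obtain ⟨P', rfl, hσ, hfv, hty⟩ := ih hμ
    refine ⟨.par P' Q, mapDomain_point _ _, fun σ => ?_, Set.union_subset_union_left _ hfv,
      hty.parL Q⟩
    have h := Trans.parL hall (hσ σ)
    rwa [mapDomain_point] at h
  | @parR P Q μ s Δ hall _ ih =>
    obtain ⟨P', rfl, hσ, hfv, hty⟩ := ih hμ
    refine ⟨.par P P', mapDomain_point _ _, fun σ => ?_, Set.union_subset_union_right _ hfv,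
      hty.parR P⟩
    have h := Trans.parR hall (hσ σ)
    rwa [mapDomain_point] at h
  | sumL _ ih =>
    obtain ⟨P', rfl, hσ, hfv, hty⟩ := ih hμ
    refine ⟨P', rfl, fun σ => .sumL (hσ σ), fun x hx => Or.inl (hfv hx),
      hty.of_imp fun G hG => ?_⟩
    cases hG; assumption
  | sumR _ ih =>
    obtain ⟨P', rfl, hσ, hfv, hty⟩ := ih hμ
    refine ⟨P', rfl, fun σ => .sumR (hσ σ), fun x hx => Or.inr (hfv hx),
      hty.of_imp fun G hG => ?_⟩
    cases hG; assumption
  | _ => exact absurd rfl hμ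

/-- The exchange of a value between two parallel components preserves types. -/
theorem VisibleTyping.synch {P P' Q Q' : Proc} {c : Chan} {v : Value}
    (hP : VisibleTyping P P' (.send c v)) (hQ : VisibleTyping Q Q' (.recv c v)) {G : Set Expr}
    (h : Typed G (.par P Q)) : Typed G (.par P' Q') := by
  cases h with
  | @par G₁ G₂ _ _ hd h₁ h₂ =>
    by_cases hc : c.ty = .qubit
    · obtain ⟨hv, hP'⟩ := (hP _ h₁).1 hc
      -- The sender owns the qubit, so by disjointness the receiver does not; this is the side
      -- condition for typing the reception.
      have hQ' := (hQ _ h₂).1 hc (Set.disjoint_left.mp hd hv)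
      have hG : G₁ ∪ G₂ = G₁ \ {v.toExpr} ∪ (G₂ ∪ {v.toExpr}) := by
        rw [Set.union_comm G₂, ← Set.union_assoc, Set.sdiff_union_self,
          Set.union_eq_self_of_subset_right (Set.singleton_subset_iff.mpr hv)]
      rw [hG]
      exact .par (Set.disjoint_union_right.mpr
        ⟨hd.mono_left Set.sdiff_subset, Set.disjoint_sdiff_left⟩) hP' hQ'
    · exact .par hd ((hP _ h₁).2 hc) ((hQ _ h₂).2 hc)

/-! ### τ-transitions as instruments. -/

/-- The distribution that results when the instrument `F` is applied to `σ` and the outcome `m`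
continues as `R m`. -/
noncomputable def outcome {S : Finset Qubit} {k : ℕ} (F : Fin k → State S →ₗ[ℂ] State S)
    (R : Fin k → Proc) (σ : State S) : PreConf →₀ ℝ :=
  mixture (outcomeProb F σ) fun m => point ⟨S, (1 / outcomeProb F σ m) • F m σ, R m⟩

theorem mapDomain_outcome {S : Finset Qubit} {k : ℕ} (F : Fin k → State S →ₗ[ℂ] State S)
    (R : Fin k → Proc) (σ : State S) (f : PreConf → PreConf) (g : Proc → Proc)
    (hfg : ∀ (τ : State S) Q, f ⟨S, τ, Q⟩ = ⟨S, τ, g Q⟩) :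
    (outcome F R σ).mapDomain f = outcome F (fun m => g (R m)) σ := by
  rw [outcome, mapDomain_mixture]
  simp_rw [mapDomain_point, hfg]
  rfl

/-- With one outcome, trace preservation forces probability 1 and the normalization disappears, so
deterministic moves fit the format of instruments. -/
theorem outcome_single {S : Finset Qubit} {F : State S →ₗ[ℂ] State S} {R : Proc} {σ : State S}
    (hF : IsInstrument fun _ : Fin 1 => F) (hσ : IsDensity σ) :
    outcome (fun _ : Fin 1 => F) (fun _ => R) σ = point ⟨S, F σ, R⟩ := by
  have h : ∀ m, outcomeProb (fun _ : Fin 1 => F) σ m = 1 := fun m => by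
    have h := hF.sum_outcomeProb hσ
    rw [Fin.sum_univ_one] at h
    rwa [Subsingleton.elim m 0]
  simp [outcome, mixture, h]

/-- The instrument `F` and the processes `R` describe a `τ`-transition of `P` under `s` for all
quantum states on `S`. -/
structure IsUniform (S : Finset Qubit) (P : Proc) (s : Sched) {k : ℕ}
    (F : Fin k → State S →ₗ[ℂ] State S) (R : Fin k → Proc) : Prop where
  instrument : IsInstrument F
  typed : ∀ G, Typed G P → ∀ m, Typed G (R m)
  freeVars : ∀ m, (R m).freeVars ⊆ P.freeVars
  trans : ∀ σ : State S, IsDensity σ → Trans σ P .tau s (outcome F R σ)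

theorem isUniform_of_point {S : Finset Qubit} {P : Proc} {s : Sched}
    {F : State S →ₗ[ℂ] State S} {R : Proc} (hF : IsInstrument fun _ : Fin 1 => F)
    (hty : ∀ G, Typed G P → Typed G R) (hfv : R.freeVars ⊆ P.freeVars)
    (ht : ∀ σ : State S, Trans σ P .tau s (point ⟨S, F σ, R⟩)) :
    IsUniform S P s (fun _ : Fin 1 => F) fun _ => R :=
  ⟨hF, fun G hG _ => hty G hG, fun _ => hfv, fun σ hσ => by
    rw [outcome_single hF hσ]
    exact ht σ⟩

/-- Every source of a τ-transition is linear in the state: silent prefixes and synchronizations use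
the identity, superoperators a single channel, measurements one map per outcome. The structural
rules change only the residual processes. Density of `ρ` is used to write the one-outcome moves as
normalized outcomes. -/
theorem Trans.uniform {S : Finset Qubit} {ρ : State S} (hρ : IsDensity ρ) {P : Proc} {μ : Act}
    {s : Sched} {Δ : PreConf →₀ ℝ} (h : Trans ρ P μ s Δ) (hμ : μ = .tau) :
    ∃ (k : ℕ) (F : Fin k → State S →ₗ[ℂ] State S) (R : Fin k → Proc),
      IsUniform S P s F R ∧ Δ = outcome F R ρ := by
  induction h with
  | iteT he _ ih =>
    obtain ⟨k, F, R, hU, rfl⟩ := ih hμ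
    subst hμ
    refine ⟨k, F, R, ⟨hU.instrument, fun G hG => ?_, fun m x hx =>
      Or.inl (Or.inr (hU.freeVars m hx)), fun σ hσ => .iteT he (hU.trans σ hσ)⟩, rfl⟩
    cases hG
    exact hU.typed G ‹_›
  | iteF he _ ih =>
    obtain ⟨k, F, R, hU, rfl⟩ := ih hμ
    subst hμ
    refine ⟨k, F, R, ⟨hU.instrument, fun G hG => ?_, fun m x hx =>
      Or.inr (hU.freeVars m hx), fun σ hσ => .iteF he (hU.trans σ hσ)⟩, rfl⟩
    cases hG
    exact hU.typed G ‹_›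
  | @tau t P =>
    refine ⟨1, _, _, isUniform_of_point (F := .id) (R := P) isInstrument_id (fun G hG => ?_)
      le_rfl fun σ => .tau, (outcome_single isInstrument_id hρ).symm⟩
    cases hG; assumption
  | @tauPair t t' P =>
    refine ⟨1, _, _, isUniform_of_point (F := .id) (R := P) isInstrument_id (fun G hG => ?_)
      le_rfl fun σ => .tauPair, (outcome_single isInstrument_id hρ).symm⟩
    cases hG; assumption
  | send => cases hμ
  | recv => cases hμ
  | @res P c μ s Δ hcμ _ ih =>
    obtain ⟨k, F, R, hU, rfl⟩ := ih hμ
    subst hμ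
    have hmap : ∀ σ : State S, (outcome F R σ).mapDomain (PreConf.restrict c) =
        outcome F (fun m => .res (R m) c) σ :=
      fun σ => mapDomain_outcome F R σ _ (fun Q => .res Q c) fun _ _ => rfl
    refine ⟨k, F, fun m => .res (R m) c, ⟨hU.instrument, fun G hG => ?_, hU.freeVars,
      fun σ hσ => ?_⟩, hmap ρ⟩
    · cases hG
      exact fun m => .res (hU.typed G ‹_› m)
    · rw [← hmap]
      exact .res hcμ (hU.trans σ hσ)
  | @op t n E es P q hq hes =>
    have hF := isInstrument_superop E q hq
    refine ⟨1, _, _, isUniform_of_point (F := applyOnLinear E.map q) (R := P) hF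
      (fun G hG => ?_) (fun x hx => Or.inr hx) fun σ => .op q hq hes,
      (outcome_single hF hρ).symm⟩
    cases hG; assumption
  | @meas t n M es y P q hq hes p hp =>
    -- The rule leaves `p` free but `hp` pins it to the traces, so each other state can supply its
    -- own probabilities.
    obtain rfl : p = outcomeProb (fun m => applyOnLinear (conjMap (M.M m)) q) ρ := funext hp
    refine ⟨M.k, fun m => applyOnLinear (conjMap (M.M m)) q, fun m => P.subst y (.nat m),
      ⟨isInstrument_meas M q hq, fun G hG m => ?_, fun m x hx =>
        Or.inr (P.freeVars_subst_subset _ _ hx), fun σ hσ => .meas q hq hes _ fun _ => rfl⟩, rfl⟩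
    cases hG with
    | meas _ _ hy hP => exact hP.subst_classical hy.symm (by simp [hy])
  | @parL P Q μ s Δ hall _ ih =>
    obtain ⟨k, F, R, hU, rfl⟩ := ih hμ
    subst hμ
    have hmap : ∀ σ : State S, (outcome F R σ).mapDomain (PreConf.parRight Q) =
        outcome F (fun m => .par (R m) Q) σ :=
      fun σ => mapDomain_outcome F R σ _ (fun P => .par P Q) fun _ _ => rfl
    refine ⟨k, F, fun m => .par (R m) Q, ⟨hU.instrument, fun G hG m => ?_,
      fun m => Set.union_subset_union_left _ (hU.freeVars m), fun σ hσ => ?_⟩, hmap ρ⟩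
    · cases hG with
      | par hd hP hQ => exact .par hd (hU.typed _ hP m) hQ
    · rw [← hmap]
      exact .parL hall (hU.trans σ hσ)
  | @parR P Q μ s Δ hall _ ih =>
    obtain ⟨k, F, R, hU, rfl⟩ := ih hμ
    subst hμ
    have hmap : ∀ σ : State S, (outcome F R σ).mapDomain (PreConf.parLeft P) =
        outcome F (fun m => .par P (R m)) σ :=
      fun σ => mapDomain_outcome F R σ _ (fun Q => .par P Q) fun _ _ => rfl
    refine ⟨k, F, fun m => .par P (R m), ⟨hU.instrument, fun G hG m => ?_,
      fun m => Set.union_subset_union_right _ (hU.freeVars m), fun σ hσ => ?_⟩, hmap ρ⟩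
    · cases hG with
      | par hd hP hQ => exact .par hd hP (hU.typed _ hQ m)
    · rw [← hmap]
      exact .parR hall (hU.trans σ hσ)
  | sumL _ ih =>
    obtain ⟨k, F, R, hU, rfl⟩ := ih hμ
    subst hμ
    refine ⟨k, F, R, ⟨hU.instrument, fun G hG => ?_, fun m x hx =>
      Or.inl (hU.freeVars m hx), fun σ hσ => .sumL (hU.trans σ hσ)⟩, rfl⟩
    cases hG
    exact hU.typed G ‹_›
  | sumR _ ih =>
    obtain ⟨k, F, R, hU, rfl⟩ := ih hμ
    subst hμ
    refine ⟨k, F, R, ⟨hU.instrument, fun G hG => ?_, fun m x hx =>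
      Or.inr (hU.freeVars m hx), fun σ hσ => .sumR (hU.trans σ hσ)⟩, rfl⟩
    cases hG
    exact hU.typed G ‹_›
  | @synchL P Q P' Q' c v t t' h₁ h₂ =>
    obtain ⟨P₁, hP₁, hσP, hfvP, htyP⟩ := h₁.visible (by simp)
    obtain ⟨Q₁, hQ₁, hσQ, hfvQ, htyQ⟩ := h₂.visible (by simp)
    -- Point distributions determine their points, so the residual named by the rule is the uniform
    -- one.
    obtain rfl : P' = P₁ := by simpa using point_injective hP₁
    obtain rfl : Q' = Q₁ := by simpa using point_injective hQ₁
    exact ⟨1, _, _, isUniform_of_point (F := .id) (R := .par P' Q') isInstrument_id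
      (fun G hG => htyP.synch htyQ hG) (Set.union_subset_union hfvP hfvQ)
      fun σ => .synchL (hσP σ) (hσQ σ), (outcome_single isInstrument_id hρ).symm⟩
  | @synchR P Q P' Q' c v t t' h₁ h₂ =>
    obtain ⟨Q₁, hQ₁, hσQ, hfvQ, htyQ⟩ := h₁.visible (by simp)
    obtain ⟨P₁, hP₁, hσP, hfvP, htyP⟩ := h₂.visible (by simp)
    obtain rfl : P' = P₁ := by simpa using point_injective hP₁
    obtain rfl : Q' = Q₁ := by simpa using point_injective hQ₁
    exact ⟨1, _, _, isUniform_of_point (F := .id) (R := .par P' Q') isInstrument_id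
      (fun G hG => (htyQ.synch htyP hG.par_comm).par_comm) (Set.union_subset_union hfvP hfvQ)
      fun σ => .synchR (hσQ σ) (hσP σ), (outcome_single isInstrument_id hρ).symm⟩

/-! ## Distributions and lifted relations -/

section Distributions

variable {A B : Type*}

/-- The distribution `∑ a, Δ a • f a`. -/
noncomputable def bind (Δ : A →₀ ℝ) (f : A → B →₀ ℝ) : B →₀ ℝ :=
  Finsupp.linearCombination ℝ f Δ

theorem bind_point (a : A) (f : A → B →₀ ℝ) : bind (point a) f = f a := by
  simp [bind, point]

theorem bind_mix (p : ℝ) (Δ₁ Δ₂ : A →₀ ℝ) (f : A → B →₀ ℝ) :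
    bind (p • Δ₁ + (1 - p) • Δ₂) f = p • bind Δ₁ f + (1 - p) • bind Δ₂ f := by
  simp only [bind, map_add, map_smul]

theorem bind_apply (Δ : A →₀ ℝ) (f : A → B →₀ ℝ) (b : B) :
    bind Δ f b = ∑ a ∈ Δ.support, Δ a * f a b := by
  simp [bind, Finsupp.linearCombination_apply, Finsupp.sum, Finsupp.finsetSum_apply]

theorem isDist_point (a : A) : IsDist (point a) :=
  ⟨fun b => by
    classical
    rw [point, Finsupp.single_apply]
    split <;> norm_num, by simp [point]⟩

theorem isDist_iff {Δ : A →₀ ℝ} :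
    IsDist Δ ↔ (∀ a, 0 ≤ Δ a) ∧ Finsupp.linearCombination ℝ (fun _ : A => (1 : ℝ)) Δ = 1 := by
  simp [IsDist, Finsupp.linearCombination_apply]

theorem IsDist.bind {Δ : A →₀ ℝ} (hΔ : IsDist Δ) {f : A → B →₀ ℝ}
    (hf : ∀ a, Δ a ≠ 0 → IsDist (f a)) : IsDist (bind Δ f) := by
  rw [isDist_iff]
  refine ⟨fun b => ?_, ?_⟩
  · rw [bind_apply]
    exact Finset.sum_nonneg fun a ha =>
      mul_nonneg (hΔ.1 a) ((hf a (Finsupp.mem_support_iff.mp ha)).1 b)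
  · rw [LqCCS.bind, Finsupp.linearCombination_apply ℝ Δ, Finsupp.sum, map_sum]
    refine Eq.trans ?_ hΔ.2
    refine Finset.sum_congr rfl fun a ha => ?_
    rw [map_smul, (isDist_iff.mp (hf a (Finsupp.mem_support_iff.mp ha))).2, smul_eq_mul, mul_one]

theorem exists_of_bind_ne_zero {Δ : A →₀ ℝ} {f : A → B →₀ ℝ} {b : B} (h : bind Δ f b ≠ 0) :
    ∃ a, Δ a ≠ 0 ∧ f a b ≠ 0 := by
  rw [bind_apply] at h
  obtain ⟨a, ha, hne⟩ := Finset.exists_ne_zero_of_sum_ne_zero h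
  exact ⟨a, Finsupp.mem_support_iff.mp ha, right_ne_zero_of_mul hne⟩

theorem isDist_mix {p : ℝ} (h0 : 0 ≤ p) (h1 : p ≤ 1) {Δ₁ Δ₂ : A →₀ ℝ} (hΔ₁ : IsDist Δ₁)
    (hΔ₂ : IsDist Δ₂) : IsDist (p • Δ₁ + (1 - p) • Δ₂) := by
  rw [isDist_iff] at *
  refine ⟨fun a => add_nonneg (mul_nonneg h0 (hΔ₁.1 a))
    (mul_nonneg (sub_nonneg.mpr h1) (hΔ₂.1 a)), ?_⟩
  rw [map_add, map_smul, map_smul, hΔ₁.2, hΔ₂.2]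
  simp

theorem isDist_mixture {ι : Type*} [Fintype ι] {p : ι → ℝ} (h0 : ∀ i, 0 ≤ p i)
    (h1 : ∑ i, p i = 1) (a : ι → A) : IsDist (mixture p fun i => point (a i)) := by
  rw [isDist_iff]
  refine ⟨fun b => ?_, by simp [mixture, point, h1]⟩
  rw [mixture, Finsupp.finsetSum_apply]
  exact Finset.sum_nonneg fun i _ => mul_nonneg (h0 i) ((isDist_point (a i)).1 b)

theorem exists_of_mixture_ne_zero {ι : Type*} [Fintype ι] {p : ι → ℝ} {a : ι → A} {b : A}
    (h : mixture p (fun i => point (a i)) b ≠ 0) : ∃ i, p i ≠ 0 ∧ a i = b := by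
  classical
  rw [mixture, Finsupp.finsetSum_apply] at h
  obtain ⟨i, -, hi⟩ := Finset.exists_ne_zero_of_sum_ne_zero h
  rw [Finsupp.smul_apply, point, Finsupp.single_apply, smul_eq_mul] at hi
  refine ⟨i, left_ne_zero_of_mul hi, ?_⟩
  by_contra hne
  simp [hne] at hi

theorem exists_of_mapDomain_ne_zero {f : A → B} {Δ : A →₀ ℝ} {b : B}
    (h : Δ.mapDomain f b ≠ 0) : ∃ a, Δ a ≠ 0 ∧ f a = b := by
  classical
  obtain ⟨a, ha, hab⟩ := Finset.mem_image.mp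
    (Finsupp.mapDomain_support (Finsupp.mem_support_iff.mpr h))
  exact ⟨a, Finsupp.mem_support_iff.mp ha, hab⟩

variable {R : A → (B →₀ ℝ) → Prop}

theorem Lift.isDist_left {Δ : A →₀ ℝ} {Θ : B →₀ ℝ} (h : Lift R Δ Θ) : IsDist Δ := by
  induction h with
  | point _ => exact isDist_point _
  | mix p h0 h1 _ _ ih₁ ih₂ => exact isDist_mix h0 h1 ih₁ ih₂

/-- A lifted relation is functional where the relation is. -/
theorem Lift.eq_bind {Δ : A →₀ ℝ} {Θ : B →₀ ℝ} (h : Lift R Δ Θ) {f : A → B →₀ ℝ}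
    (hf : ∀ a, Δ a ≠ 0 → ∀ Ξ, R a Ξ → Ξ = f a) : Θ = bind Δ f := by
  induction h with
  | @point a Θ hR => rw [bind_point, hf a (by simp [LqCCS.point]) Θ hR]
  | @mix Δ₁ Δ₂ Θ₁ Θ₂ p h0 h1 hL₁ hL₂ ih₁ ih₂ =>
    have hnn₁ := hL₁.isDist_left.1
    have hnn₂ := hL₂.isDist_left.1
    have hp := sub_nonneg.mpr h1
    rw [bind_mix]
    congr 1
    -- A component of weight 0 need not have its support inside that of the mixture, so `hf` may not
    -- apply to it; but then its term vanishes.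
    · rcases h0.eq_or_lt with rfl | h0'
      · simp
      · rw [ih₁ fun a ha => hf a (ne_of_gt (add_pos_of_pos_of_nonneg
          (mul_pos h0' ((hnn₁ a).lt_of_ne' ha)) (mul_nonneg hp (hnn₂ a))))]
    · rcases hp.eq_or_lt with h | h0'
      · simp [← h]
      · rw [ih₂ fun a ha => hf a (ne_of_gt (add_pos_of_nonneg_of_pos
          (mul_nonneg h0 (hnn₁ a)) (mul_pos h0' ((hnn₂ a).lt_of_ne' ha))))]

/-- A lifted relation is total where the relation is. -/
theorem lift_bind {Δ : A →₀ ℝ} (hΔ : IsDist Δ) {f : A → B →₀ ℝ}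
    (hf : ∀ a, Δ a ≠ 0 → R a (f a)) : Lift R Δ (bind Δ f) := by
  classical
  -- Induction on the size of the support: split off one point and renormalize the rest, unless that
  -- point already has all the mass.
  induction hn : Δ.support.card using Nat.strong_induction_on generalizing Δ with
  | _ n ih =>
    have hne : Δ.support.Nonempty := by
      rw [Finset.nonempty_iff_ne_empty, ne_eq, Finsupp.support_eq_empty]
      rintro rfl
      simpa using hΔ.2
    obtain ⟨a, ha⟩ := hne
    have ha0 : Δ a ≠ 0 := Finsupp.mem_support_iff.mp ha
    have hsum : Δ a + ∑ b ∈ (Δ.erase a).support, Δ b = 1 := by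
      rw [Finsupp.support_erase, Finset.add_sum_erase _ _ ha]
      exact hΔ.2
    have hle : Δ a ≤ 1 := by
      have := Finset.sum_nonneg fun b (_ : b ∈ (Δ.erase a).support) => hΔ.1 b
      linarith
    have hdec : Δ = Δ a • point a + Δ.erase a := by
      rw [point, Finsupp.smul_single, smul_eq_mul, mul_one, Finsupp.single_add_erase]
    rcases hle.eq_or_lt with h1 | h1
    · have hz : Δ.erase a = 0 := by
        rw [← Finsupp.support_eq_empty, Finset.eq_empty_iff_forall_notMem]
        intro b hb
        have h0 : ∑ b ∈ (Δ.erase a).support, Δ b = 0 := by linarith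
        rw [Finset.sum_eq_zero_iff_of_nonneg fun b _ => hΔ.1 b] at h0
        rw [Finsupp.support_erase] at hb h0
        exact Finsupp.mem_support_iff.mp (Finset.mem_of_mem_erase hb) (h0 b hb)
      rw [hz, h1, one_smul, add_zero] at hdec
      rw [hdec, bind_point]
      exact .point (hf a ha0)
    · have hpos : 0 < 1 - Δ a := sub_pos.mpr h1
      set Δ₂ := (1 - Δ a)⁻¹ • Δ.erase a with hΔ₂
      have hmix : Δ = Δ a • point a + (1 - Δ a) • Δ₂ := by
        rw [hΔ₂, smul_smul, mul_inv_cancel₀ hpos.ne', one_smul]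
        exact hdec
      have hsupp : Δ₂.support = Δ.support.erase a := by
        rw [hΔ₂, Finsupp.support_smul_eq (inv_ne_zero hpos.ne'), Finsupp.support_erase]
      have hd : IsDist Δ₂ := by
        refine ⟨fun b => ?_, ?_⟩
        · rw [hΔ₂, Finsupp.smul_apply, smul_eq_mul, Finsupp.erase_apply]
          refine mul_nonneg (inv_nonneg.mpr hpos.le) ?_
          split
          · exact le_rfl
          · exact hΔ.1 b
        · have h0 : (∑ b ∈ (Δ.erase a).support, Δ b) = 1 - Δ a := by linarith
          rw [Finsupp.sum, hsupp, ← inv_mul_cancel₀ hpos.ne', ← h0, Finsupp.support_erase,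
            Finset.mul_sum]
          refine Finset.sum_congr rfl fun b hb => ?_
          rw [hΔ₂, Finsupp.smul_apply, Finsupp.erase_ne (Finset.ne_of_mem_erase hb), smul_eq_mul,
            ← Finsupp.support_erase, h0]
      have hrec := ih _ (by rw [hsupp, ← hn]; exact Finset.card_erase_lt_of_mem ha) hd
        (fun b hb => hf b (Finsupp.mem_support_iff.mp (Finset.mem_of_mem_erase
          (hsupp ▸ Finsupp.mem_support_iff.mpr hb)))) rfl
      have key := Lift.mix (Δ a) (hΔ.1 a) hle (Lift.point (hf a ha0)) hrec
      rw [← hmix] at key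
      convert key using 1
      conv_lhs => rw [hmix]
      rw [bind_mix, bind_point]

end Distributions

/-! ## Evolution of configurations -/

section Outcomes

variable {S : Finset Qubit} {P : Proc} {s : Sched} {k : ℕ} {F : Fin k → State S →ₗ[ℂ] State S}
  {R : Fin k → Proc} {σ : State S}

theorem IsInstrument.isDist_outcome (hF : IsInstrument F) (hσ : IsDensity σ) :
    IsDist (outcome F R σ) :=
  isDist_mixture (hF.outcomeProb_nonneg hσ.1) (hF.sum_outcomeProb hσ) _

theorem IsUniform.hasType (hU : IsUniform S P s F R) {C : PreConf} (hC : outcome F R σ C ≠ 0)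
    {A A' : Finset Qubit} (h : PreConf.HasType A A' ⟨S, σ, P⟩) : C.HasType A A' := by
  obtain ⟨m, -, rfl⟩ := exists_of_mixture_ne_zero hC
  exact ⟨h.1, hU.typed _ h.2.1 m, h.2.2⟩

/-- Subject reduction. Normalizing fails for outcomes of probability 0, but these are not in the
support. -/
theorem IsUniform.wellTyped (hU : IsUniform S P s F R) {C : PreConf} (hC : outcome F R σ C ≠ 0)
    (h : PreConf.WellTyped ⟨S, σ, P⟩) : C.WellTyped := by
  obtain ⟨hσ, hcl, A, A', hty⟩ := h
  refine ⟨?_, ?_, A, A', hU.hasType hC hty⟩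
  · obtain ⟨m, hm, rfl⟩ := exists_of_mixture_ne_zero hC
    exact hU.instrument.isDensity_normalized hσ.1 hm
  · obtain ⟨m, -, rfl⟩ := exists_of_mixture_ne_zero hC
    exact Set.subset_eq_empty (hU.freeVars m) hcl

end Outcomes

theorem wellTyped_of_mem_conf {C : PreConf} (hC : C ∈ Conf) : C.WellTyped := by
  obtain ⟨D, hD, hCD⟩ := hC
  exact hD.1 C hCD

theorem mem_conf_of_trans {C C' : PreConf} (hC : C ∈ Conf) {μ : Act} {s : Sched}
    {Δ : PreConf →₀ ℝ} (h : Trans C.ρ C.P μ s Δ) (hΔ : ∀ C', Δ C' ≠ 0 → C'.WellTyped)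
    (hC' : Δ C' ≠ 0) : C' ∈ Conf := by
  obtain ⟨D, hD, hCD⟩ := hC
  exact ⟨D, hD, hD.2.1 C hCD μ s Δ h hΔ C' hC'⟩

theorem isDist_mapDomain {A B : Type*} {Δ : A →₀ ℝ} (h : IsDist Δ) (f : A → B) :
    IsDist (Δ.mapDomain f) := by
  have hbind : Δ.mapDomain f = LqCCS.bind Δ fun a => point (f a) := by
    simp [LqCCS.bind, Finsupp.linearCombination_apply, point, Finsupp.mapDomain]
  rw [hbind]
  exact h.bind fun a _ => isDist_point _

/-- The well-typed transitions of a configuration are determined by the scheduler. -/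
theorem trans_unique {C : PreConf} (hC : C ∈ Conf) {μ : Act} {s : Sched} {Δ₁ Δ₂ : PreConf →₀ ℝ}
    (h₁ : Trans C.ρ C.P μ s Δ₁) (h₂ : Trans C.ρ C.P μ s Δ₂) (hd₁ : IsDist Δ₁) (hd₂ : IsDist Δ₂)
    (hw₁ : ∀ C', Δ₁ C' ≠ 0 → C'.WellTyped) (hw₂ : ∀ C', Δ₂ C' ≠ 0 → C'.WellTyped) :
    Δ₁ = Δ₂ := by
  obtain ⟨D, hD, hCD⟩ := hC
  have hinj : Function.Injective (some : PreConf → Option PreConf) := Option.some_injective _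
  have hover : ∀ {Δ : PreConf →₀ ℝ}, Trans C.ρ C.P μ s Δ → IsDist Δ →
      (∀ C', Δ C' ≠ 0 → C'.WellTyped) → IsDistOver D (Δ.mapDomain some) := by
    intro Δ h hd hw
    refine ⟨isDist_mapDomain hd _, fun C' hC' => ?_⟩
    rw [Finsupp.mapDomain_apply hinj] at hC'
    exact hD.2.1 C hCD μ s Δ h hw C' hC'
  have hCpt : IsDistOver D (point (some C)) := by
    refine ⟨isDist_point _, fun C' hC' => ?_⟩
    by_cases hCC : C = C'
    · exact hCC ▸ hCD
    · exact absurd (Finsupp.single_eq_of_ne fun h => hCC (Option.some.inj h).symm) hC'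
  -- Determinism is assumed for lifted steps; it is applied to the point distributions at the
  -- configuration and at the scheduler.
  refine Finsupp.mapDomain_injective hinj (hD.2.2 (point (some C)) μ (point s) _ _ hCpt
    (isDist_point s) (hover h₁ hd₁ hw₁) (hover h₂ hd₂ hw₂) ?_ ?_)
  · exact .point (.point (.step h₁))
  · exact .point (.point (.step h₂))

/-- The data of a `τ`-transition that is uniform in the quantum state. -/
structure UniformTrans (S : Finset Qubit) (P : Proc) (s : Sched) where
  k : ℕ
  F : Fin k → State S →ₗ[ℂ] State S
  R : Fin k → Proc
  isUniform : IsUniform S P s F R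

open Classical in
/-- The distribution reached by a `τ`-transition, which depends on the scheduler alone. -/
noncomputable def evolve : Option PreConf → Sched → Option PreConf →₀ ℝ
  | none, _ => point none
  | some C, s =>
    if h : Nonempty (UniformTrans C.S C.P s) then
      (outcome h.some.F h.some.R C.ρ).mapDomain some
    else point none

theorem evolve_eq_or (C : PreConf) (s : Sched) :
    (∃ U : UniformTrans C.S C.P s, evolve (some C) s = (outcome U.F U.R C.ρ).mapDomain some) ∨
      (IsEmpty (UniformTrans C.S C.P s) ∧ evolve (some C) s = point none) := by
  by_cases h : Nonempty (UniformTrans C.S C.P s)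
  · exact Or.inl ⟨h.some, by rw [evolve, dif_pos h]⟩
  · exact Or.inr ⟨not_nonempty_iff.mp h, by rw [evolve, dif_neg h]⟩

theorem Trans.exists_uniformTrans {C : PreConf} (hC : C.WellTyped) {s : Sched}
    {Δ : PreConf →₀ ℝ} (h : Trans C.ρ C.P .tau s Δ) :
    ∃ U : UniformTrans C.S C.P s, Δ = outcome U.F U.R C.ρ := by
  obtain ⟨k, F, R, hU, rfl⟩ := h.uniform hC.1 rfl
  exact ⟨⟨k, F, R, hU⟩, rfl⟩

/-- Membership in the configurations extended with the deadlock. -/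
def InConfBot (C : Option PreConf) : Prop := ∀ C', C = some C' → C' ∈ Conf

theorem IsDistOver.inConfBot {Δ : Option PreConf →₀ ℝ} (h : IsDistOver Conf Δ)
    {C : Option PreConf} (hC : Δ C ≠ 0) : InConfBot C := by
  rintro C' rfl
  exact h.2 C' hC

theorem botTrans_evolve {C : Option PreConf} (hC : InConfBot C) (s : Sched) :
    BotTrans C .tau s (evolve C s) := by
  cases C with
  | none => exact .bot
  | some C =>
    have hw := wellTyped_of_mem_conf (hC C rfl)
    obtain ⟨U, hU⟩ | ⟨hE, hU⟩ := evolve_eq_or C s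
    · rw [hU]
      exact .step (U.isUniform.trans _ hw.1)
    · rw [hU]
      refine .stuck fun ⟨Δ, h⟩ => ?_
      obtain ⟨U, -⟩ := h.exists_uniformTrans hw
      exact hE.elim U

/-- `evolve` picks an arbitrary uniform transition. Determinism makes the choice harmless, and a
transition from one state already rules out the stuck case. -/
theorem eq_evolve_of_botTrans {C : Option PreConf} (hC : InConfBot C) {s : Sched}
    {Ξ : Option PreConf →₀ ℝ} (h : BotTrans C .tau s Ξ) : Ξ = evolve C s := by
  generalize hμ : Act.tau = μ at h
  cases h with
  | @step C _ _ Δ h =>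
    subst hμ
    have hw := wellTyped_of_mem_conf (hC C rfl)
    obtain ⟨V, rfl⟩ := h.exists_uniformTrans hw
    obtain ⟨U, hU⟩ | ⟨hE, -⟩ := evolve_eq_or C s
    · rw [hU, trans_unique (hC C rfl) h (U.isUniform.trans _ hw.1)
        (V.isUniform.instrument.isDist_outcome hw.1) (U.isUniform.instrument.isDist_outcome hw.1)
        (fun C' hC' => V.isUniform.wellTyped hC' hw) fun C' hC' => U.isUniform.wellTyped hC' hw]
    · exact hE.elim V
  | @stuck C _ _ h =>
    subst hμ
    have hw := wellTyped_of_mem_conf (hC C rfl)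
    obtain ⟨U, -⟩ | ⟨-, hU⟩ := evolve_eq_or C s
    · exact absurd ⟨_, U.isUniform.trans _ hw.1⟩ h
    · exact hU.symm
  | bot => rfl

theorem isDistOver_evolve {C : Option PreConf} (hC : InConfBot C) (s : Sched) :
    IsDistOver Conf (evolve C s) := by
  have hbot : IsDistOver Conf (point none) :=
    ⟨isDist_point _, fun C' hC' => absurd (Finsupp.single_eq_of_ne (by simp)) hC'⟩
  cases C with
  | none => exact hbot
  | some C =>
    have hw := wellTyped_of_mem_conf (hC C rfl)
    obtain ⟨U, hU⟩ | ⟨-, hU⟩ := evolve_eq_or C s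
    · rw [hU]
      refine ⟨isDist_mapDomain (U.isUniform.instrument.isDist_outcome hw.1) _, fun C' hC' => ?_⟩
      rw [Finsupp.mapDomain_apply (Option.some_injective _)] at hC'
      exact mem_conf_of_trans (hC C rfl) (U.isUniform.trans _ hw.1)
        (fun C' hC' => U.isUniform.wellTyped hC' hw) hC'
    · rw [hU]
      exact hbot

theorem distHasType_evolve {C : Option PreConf} {s : Sched} {A A' : Finset Qubit}
    (hC : ∀ C', C = some C' → C'.HasType A A') : DistHasType A A' (evolve C s) := by
  have hbot : DistHasType A A' (point none) :=
    fun C' hC' => absurd (Finsupp.single_eq_of_ne (by simp)) hC'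
  cases C with
  | none => exact hbot
  | some C =>
    obtain ⟨U, hU⟩ | ⟨-, hU⟩ := evolve_eq_or C s
    · rw [hU]
      intro C' hC'
      rw [Finsupp.mapDomain_apply (Option.some_injective _)] at hC'
      exact U.isUniform.hasType hC' (hC C rfl)
    · rw [hU]
      exact hbot

section Steps

variable {Δ Δ' : Option PreConf →₀ ℝ} {δ : Sched →₀ ℝ}

theorem step_bind_evolve (hΔ : IsDistOver Conf Δ) (hδ : IsDist δ) :
    Step Δ .tau δ (bind Δ fun C => bind δ (evolve C)) :=
  lift_bind hΔ.1 fun _ hC => lift_bind hδ fun s _ => botTrans_evolve (hΔ.inConfBot hC) s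

theorem Step.eq_bind_evolve (hΔ : IsDistOver Conf Δ) (h : Step Δ .tau δ Δ') :
    Δ' = bind Δ fun C => bind δ (evolve C) :=
  Lift.eq_bind h fun _ hC _ hΞ =>
    Lift.eq_bind hΞ fun _ _ _ hs => eq_evolve_of_botTrans (hΔ.inConfBot hC) hs

theorem isDistOver_bind_evolve (hΔ : IsDistOver Conf Δ) (hδ : IsDist δ) :
    IsDistOver Conf (bind Δ fun C => bind δ (evolve C)) := by
  refine ⟨hΔ.1.bind fun C hC => hδ.bind fun s _ =>
    (isDistOver_evolve (hΔ.inConfBot hC) s).1, fun C' hC' => ?_⟩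
  obtain ⟨C, hC, h⟩ := exists_of_bind_ne_zero hC'
  obtain ⟨s, -, h⟩ := exists_of_bind_ne_zero h
  exact (isDistOver_evolve (hΔ.inConfBot hC) s).2 C' h

theorem distHasType_bind_evolve {A A' : Finset Qubit} (hΔ : DistHasType A A' Δ) :
    DistHasType A A' (bind Δ fun C => bind δ (evolve C)) := by
  intro C' hC'
  obtain ⟨C, hC, h⟩ := exists_of_bind_ne_zero hC'
  obtain ⟨s, -, h⟩ := exists_of_bind_ne_zero h
  refine distHasType_evolve ?_ C' h
  rintro C₀ rfl
  exact hΔ C₀ hC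

end Steps

/-! ## Aggregated quantum states -/

/-- The process of a configuration, with the quantum state if this is a state of `S`. -/
noncomputable def classify (S : Finset Qubit) : Option PreConf → Proc →₀ State S
  | none => 0
  | some C => if h : C.S = S then Finsupp.single C.P (h ▸ C.ρ) else 0

/-- For each process, the sum of the states of `S` that occur with it in a distribution, weighted
with their probabilities. -/
noncomputable def aggregate (S : Finset Qubit) :
    (Option PreConf →₀ ℝ) →ₗ[ℝ] Proc →₀ State S :=
  Finsupp.linearCombination ℝ (classify S)

theorem classify_self (S : Finset Qubit) (ρ : State S) (P : Proc) :
    classify S (some ⟨S, ρ, P⟩) = Finsupp.single P ρ := by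
  simp [classify]

theorem classify_of_ne {S : Finset Qubit} {C : PreConf} (h : C.S ≠ S) :
    classify S (some C) = 0 := by
  simp [classify, h]

theorem aggregate_point (S : Finset Qubit) (C : Option PreConf) :
    aggregate S (point C) = classify S C := by
  simp [aggregate, point]

theorem aggregate_mixture (S : Finset Qubit) {ι : Type*} [Fintype ι] (p : ι → ℝ)
    (C : ι → Option PreConf) :
    aggregate S (mixture p fun i => point (C i)) = ∑ i, p i • classify S (C i) := by
  simp [mixture, aggregate_point]

theorem aggregate_bind (S : Finset Qubit) {A : Type*} (Δ : A →₀ ℝ)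
    (f : A → Option PreConf →₀ ℝ) :
    aggregate S (bind Δ f) = Finsupp.linearCombination ℝ (fun a => aggregate S (f a)) Δ := by
  simp [bind, Finsupp.linearCombination_apply, Finsupp.sum]

/-- A linear function of the classification of configurations is a function of the aggregate. -/
theorem linearCombination_eq_of_classify {V : Type*} [AddCommMonoid V] [Module ℝ V]
    (S : Finset Qubit) (L : (Proc →₀ State S) →ₗ[ℝ] V) {f : Option PreConf → V}
    {Δ : Option PreConf →₀ ℝ} (hf : ∀ C, Δ C ≠ 0 → f C = L (classify S C)) :
    Finsupp.linearCombination ℝ f Δ = L (aggregate S Δ) := by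
  rw [aggregate, Finsupp.linearCombination_apply, Finsupp.linearCombination_apply, Finsupp.sum,
    Finsupp.sum, map_sum]
  refine Finset.sum_congr rfl fun C hC => ?_
  rw [map_smul, hf C (Finsupp.mem_support_iff.mp hC)]

/-- Each normalized state is weighted by its own probability, so only the unnormalized `U.F m σ`
remain. -/
theorem aggregate_outcome {S : Finset Qubit} {P : Proc} {s : Sched} (U : UniformTrans S P s)
    {σ : State S} (hσ : IsDensity σ) :
    aggregate S ((outcome U.F U.R σ).mapDomain some) =
      ∑ m, Finsupp.single (U.R m) (U.F m σ) := by
  rw [outcome, mapDomain_mixture]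
  simp_rw [mapDomain_point]
  rw [aggregate_mixture]
  simp_rw [classify_self, Finsupp.smul_single, U.isUniform.instrument.smul_normalized hσ.1]

theorem aggregate_outcome_of_ne {S T : Finset Qubit} (hST : S ≠ T) {P : Proc} {s : Sched}
    (U : UniformTrans S P s) (σ : State S) :
    aggregate T ((outcome U.F U.R σ).mapDomain some) = 0 := by
  rw [outcome, mapDomain_mixture]
  simp_rw [mapDomain_point]
  rw [aggregate_mixture]
  exact Finset.sum_eq_zero fun m _ => by rw [classify_of_ne hST, smul_zero]

open Classical in
/-- The evolution of the quantum state of a process, as a linear map. -/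
noncomputable def evolveState (S : Finset Qubit) (s : Sched) (P : Proc) :
    State S →ₗ[ℝ] Proc →₀ State S :=
  if h : Nonempty (UniformTrans S P s) then
    ∑ m, Finsupp.lsingle (h.some.R m) ∘ₗ (h.some.F m).restrictScalars ℝ
  else 0

theorem aggregate_evolve (S : Finset Qubit) {C : Option PreConf} (hC : InConfBot C) (s : Sched) :
    aggregate S (evolve C s) = Finsupp.lsum ℝ (evolveState S s) (classify S C) := by
  have hbot : aggregate S (point none) = 0 := by rw [aggregate_point]; rfl
  cases C with
  | none => rw [evolve, hbot, classify, map_zero]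
  | some C =>
    obtain ⟨T, ρ, P⟩ := C
    have hw := wellTyped_of_mem_conf (hC _ rfl)
    by_cases hT : T = S
    · subst hT
      rw [classify_self, Finsupp.lsum_single, evolve, evolveState]
      -- `evolve` and `evolveState` choose the same witness, since the existence of a uniform
      -- transition does not involve the state.
      split
      · rw [aggregate_outcome _ hw.1]
        simp
      · rw [hbot, LinearMap.zero_apply]
    · rw [classify_of_ne hT, map_zero]
      obtain ⟨U, hU⟩ | ⟨-, hU⟩ := evolve_eq_or ⟨T, ρ, P⟩ s
      · rw [hU]
        exact aggregate_outcome_of_ne hT U ρ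
      · rw [hU, hbot]

/-- The heart of the argument: the linear map on the right depends on `S` and `δ` but not on `Δ`, so
equal aggregates evolve to equal aggregates. -/
theorem aggregate_bind_evolve (S : Finset Qubit) {Δ : Option PreConf →₀ ℝ}
    (hΔ : IsDistOver Conf Δ) (δ : Sched →₀ ℝ) :
    aggregate S (bind Δ fun C => bind δ (evolve C)) =
      (Finsupp.linearCombination ℝ (fun s => Finsupp.lsum ℝ (evolveState S s)) δ)
        (aggregate S Δ) := by
  rw [aggregate_bind]
  refine linearCombination_eq_of_classify S _ fun C hC => ?_
  rw [aggregate_bind]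
  simp_rw [aggregate_evolve S (hΔ.inConfBot hC)]
  simp [Finsupp.linearCombination_apply, Finsupp.sum, LinearMap.sum_apply]

theorem aggregate_apply (S : Finset Qubit) {A A' : Finset Qubit} (B : Context A A')
    (Δ : Option PreConf →₀ ℝ) :
    aggregate S (B.apply Δ) =
      Finsupp.lmapDomain (State S) ℝ (fun P => Proc.par P B.Q) (aggregate S Δ) := by
  rw [Context.apply, aggregate, Finsupp.linearCombination_mapDomain]
  refine linearCombination_eq_of_classify S _ fun C _ => ?_
  cases C with
  | none => simp [classify]
  | some C =>
    obtain ⟨T, ρ, P⟩ := C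
    by_cases hT : T = S
    · subst hT
      rw [classify_self, Finsupp.lmapDomain_apply, Finsupp.mapDomain_single]
      exact classify_self _ _ _
    · rw [classify_of_ne hT, map_zero]
      exact classify_of_ne hT

/-- The probability of the deadlock is determined by the traces of the aggregated states. -/
theorem mass_eq_aggregate {A A' : Finset Qubit} {Δ : Option PreConf →₀ ℝ}
    (hΔ : IsDistOver Conf Δ) (hty : DistHasType A A' Δ) :
    mass Δ = Finsupp.lsum ℝ (fun _ : Proc => Complex.reLm ∘ₗ
      (Matrix.traceLinearMap (A → Fin 2) ℝ ℂ)) (aggregate A Δ) := by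
  classical
  -- The mass is the expectation of the indicator of non-deadlock. On the support this indicator is
  -- the trace of the classified state: 1 for a configuration, all of which live on `A`, and 0 for
  -- deadlock.
  rw [← linearCombination_eq_of_classify A _ (f := fun C => 1 - if none = C then 1 else 0)]
  · have h1 := (isDist_iff.mp hΔ.1).2
    rw [Finsupp.linearCombination_apply] at h1 ⊢
    simp only [smul_eq_mul, mul_sub, mul_one, mul_ite, mul_zero] at h1 ⊢
    rw [Finsupp.sum_sub, h1, mass]
    simp [Finsupp.sum_ite_eq]
  · intro C hC
    cases C with
    | none => simp [classify]
    | some C =>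
      obtain ⟨T, ρ, P⟩ := C
      obtain rfl : T = A := (hty _ hC).1
      rw [classify_self, Finsupp.lsum_single]
      have := (wellTyped_of_mem_conf (hΔ.2 _ hC)).1.2
      simp only at this
      simp [this]

/-! ## The bisimulation -/

/-- Distributions of configurations of the same type with the same aggregated states. -/
structure SameAggregate (Δ Θ : Option PreConf →₀ ℝ) : Prop where
  left : IsDistOver Conf Δ
  right : IsDistOver Conf Θ
  type : ∃ A A', DistHasType A A' Δ ∧ DistHasType A A' Θ
  aggregate : ∀ S, aggregate S Δ = aggregate S Θ

theorem SameAggregate.symm {Δ Θ : Option PreConf →₀ ℝ} (h : SameAggregate Δ Θ) :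
    SameAggregate Θ Δ :=
  ⟨h.right, h.left, let ⟨A, A', h₁, h₂⟩ := h.type; ⟨A, A', h₂, h₁⟩, fun S => (h.aggregate S).symm⟩

theorem SameAggregate.step {Δ Θ Δ' : Option PreConf →₀ ℝ} (h : SameAggregate Δ Θ)
    {δ : Sched →₀ ℝ} (hδ : IsDist δ) (hΔ' : Step Δ .tau δ Δ') :
    ∃ Θ', Step Θ .tau δ Θ' ∧ SameAggregate Δ' Θ' := by
  obtain rfl := hΔ'.eq_bind_evolve h.left
  obtain ⟨A, A', hΔ, hΘ⟩ := h.type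
  refine ⟨_, step_bind_evolve h.right hδ, isDistOver_bind_evolve h.left hδ,
    isDistOver_bind_evolve h.right hδ,
    ⟨A, A', distHasType_bind_evolve hΔ, distHasType_bind_evolve hΘ⟩, fun S => ?_⟩
  rw [aggregate_bind_evolve S h.left, aggregate_bind_evolve S h.right, h.aggregate]

theorem Context.exists_distHasType_apply {A A' : Finset Qubit} (B : Context A A') :
    ∃ A₁, ∀ Δ, DistHasType A A' Δ → DistHasType A A₁ (B.apply Δ) := by
  obtain ⟨A'', hsub, hdis, hQ⟩ := B.typed
  -- The type depends only on the hole and the context, so the two related distributions again share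
  -- one.
  refine ⟨A' ∪ A'', fun Δ hΔ C hC => ?_⟩
  obtain ⟨C₀, hC₀, hmap⟩ := exists_of_mapDomain_ne_zero hC
  obtain ⟨C₁, rfl, rfl⟩ := Option.map_eq_some_iff.mp hmap
  obtain ⟨hS, hP, hA'⟩ := hΔ C₁ hC₀
  refine ⟨hS, ?_, Finset.union_subset hA' hsub⟩
  have hctx : ctx (A' ∪ A'') = ctx A' ∪ ctx A'' := by
    ext e
    simp [ctx, or_and_right, exists_or]
  rw [hctx]
  refine .par ?_ hP hQ
  rw [Set.disjoint_left]
  rintro _ ⟨q, hq, rfl⟩ ⟨q', hq', hqq⟩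
  cases hqq
  exact Finset.disjoint_left.mp hdis hq hq'

theorem isSaturatedBisimulation_sameAggregate : IsSaturatedBisimulation SameAggregate := by
  intro Δ Θ h
  obtain ⟨A, A', hΔ, hΘ⟩ := h.type
  refine ⟨h.left, h.right, A, A', hΔ, hΘ, ?_, fun B hBΔ hBΘ δ hδ => ?_⟩
  · rw [mass_eq_aggregate h.left hΔ, mass_eq_aggregate h.right hΘ, h.aggregate]
  · obtain ⟨A₁, hA₁⟩ := B.exists_distHasType_apply
    have hB : SameAggregate (B.apply Δ) (B.apply Θ) :=
      ⟨hBΔ, hBΘ, ⟨A, A₁, hA₁ Δ hΔ, hA₁ Θ hΘ⟩, fun S => by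
        rw [aggregate_apply, aggregate_apply, h.aggregate]⟩
    refine ⟨fun Δ' hΔ' => hB.step hδ hΔ', fun Θ' hΘ' => ?_⟩
    obtain ⟨Δ', hstep, hR⟩ := hB.symm.step hδ hΘ'
    exact ⟨Δ', hstep, hR.symm⟩

theorem isDistOver_mixture {ι : Type*} [Fintype ι] {p : ι → ℝ} (h0 : ∀ i, 0 ≤ p i)
    (h1 : ∑ i, p i = 1) {D : Set PreConf} {C : ι → PreConf} (hC : ∀ i, C i ∈ D) :
    IsDistOver D (mixture p fun i => point (some (C i))) := by
  refine ⟨isDist_mixture h0 h1 _, fun C' hC' => ?_⟩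
  obtain ⟨i, -, hi⟩ := exists_of_mixture_ne_zero hC'
  cases hi
  exact hC i

end LqCCS

theorem mainTheorem2 {ι κ : Type*} [Fintype ι] [Fintype κ]
    (S : Finset LqCCS.Qubit) (P : LqCCS.Proc)
    (p : ι → ℝ) (q : κ → ℝ) (ρ : ι → LqCCS.State S) (σ : κ → LqCCS.State S)
    (hp0 : ∀ i, 0 ≤ p i) (hp1 : ∑ i, p i = 1)
    (hq0 : ∀ j, 0 ≤ q j) (hq1 : ∑ j, q j = 1)
    (hρ : ∀ i, (⟨S, ρ i, P⟩ : LqCCS.PreConf) ∈ LqCCS.Conf)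
    (hσ : ∀ j, (⟨S, σ j, P⟩ : LqCCS.PreConf) ∈ LqCCS.Conf)
    (h : ∑ i, p i • ρ i = ∑ j, q j • σ j) :
    LqCCS.SaturatedBisimilar
      (LqCCS.mixture p fun i => LqCCS.point (some ⟨S, ρ i, P⟩))
      (LqCCS.mixture q fun j => LqCCS.point (some ⟨S, σ j, P⟩)) := by
  open LqCCS in
  refine ⟨SameAggregate, isSaturatedBisimulation_sameAggregate,
    isDistOver_mixture hp0 hp1 hρ, isDistOver_mixture hq0 hq1 hσ, ?_, fun T => ?_⟩
  -- Weights with sum 1 need an index. One member then yields the type of all, since they share `S`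
  -- and `P`.
  · have hne : Nonempty ι := by
      by_contra hemp
      rw [not_nonempty_iff] at hemp
      simp at hp1
    obtain ⟨-, -, A, A', hS, hP, hA⟩ := wellTyped_of_mem_conf (hρ hne.some)
    refine ⟨A, A', fun C hC => ?_, fun C hC => ?_⟩
    · obtain ⟨i, -, hi⟩ := exists_of_mixture_ne_zero hC
      cases hi
      exact ⟨hS, hP, hA⟩
    · obtain ⟨j, -, hj⟩ := exists_of_mixture_ne_zero hC
      cases hj
      exact ⟨hS, hP, hA⟩
  -- On `S` each aggregate is the averaged state placed at `P`, so the hypothesis on averages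
  -- applies; on any other set of qubits both vanish.
  · rw [aggregate_mixture, aggregate_mixture]
    by_cases hST : S = T
    · subst hST
      simp_rw [classify_self, Finsupp.smul_single]
      rw [← Finsupp.single_finsetSum, ← Finsupp.single_finsetSum, h]
    · have hz : ∀ τ : State S, classify T (some ⟨S, τ, P⟩) = 0 := fun τ => classify_of_ne hST
      simp [hz]
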